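/- Let $(\Omega,\mathcal F,\mathbb P,(\mathcal F_t)_{t\ge 0})$ be a filtered probability space such that every $\mathcal F_t$ contains all $\mathbb P$-null sets of $\mathcal F$. Let $X=(X_t)_{t\ge 0}$ be an $\mathbb R^n$-valued Lévy process with respect to $(\mathcal F_t)$, that is: $X$ is adapted; $X_0=0$ a.s.; for all $s,t\ge 0$ the increment $X_{t+s}-X_t$ is independent of $\mathcal F_t$ and has the law of $X_s$; and $X$ is continuous in probability. Assume that all sample paths of $X$ are càdlàg, that $X$ is centred ($\mathbb E[X_t]=0$ for all $t$), and that almost surely $|X_t-X_{t-}|\le 1$ for all $t$. For $t\ge 0$ let $N_t(B)$ be the number of times $s\in(0,t]$ at which $X_s-X_{s-}\in B\setminus\{0\}$, and let $\nu(B):=\mathbb E[N_1(B)]$, for Borel sets $B\subseteq\mathbb R^n$. Then there are processes $X^c$ and $X^d$ with $$X_t=X^c_t+X^d_t\qquad\text{for all } t\ge 0,$$ such that $X^c$ is an $(\mathcal F_t)$-martingale with continuous sample paths, and $$X^d_t=\int_{|x|\le 1}x\,\bigl(N_t(dx)-t\,\nu(dx)\bigr),$$ where this integral is understood in the $L^2$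 sense: $X^d$ is a càdlàg square-integrable $(\mathcal F_t)$-martingale and, for every $t\ge 0$, $$\int_{\varepsilon<|x|\le 1}x\,N_t(dx)-t\int_{\varepsilon<|x|\le 1}x\,\nu(dx)\;\longrightarrow\;X^d_t\quad\text{in }L^2(\mathbb P)\text{ as }\varepsilon\downarrow 0.$$ Moreover $$\int_{|x|\le 1}|x|^2\,\nu(dx)<\infty .$$ -/

import Mathlib

open MeasureTheory ProbabilityTheory Filter Topology
open scoped NNReal ENNReal

namespace LevyIto

noncomputable section

/-- A path on `[0, ∞)` is càdlàg: right-continuous with left limits. (At `0` there is no left limit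
to take: the filter `𝓝[<] 0` on `ℝ≥0` is trivial.) -/
def IsCadlag {E : Type*} [TopologicalSpace E] (x : ℝ≥0 → E) : Prop :=
  ∀ t, ContinuousWithinAt x (Set.Ici t) t ∧ ∃ l, Tendsto x (𝓝[<] t) (𝓝 l)

/-- The jump `x_t - x_{t-}` of a path at time `t` (it is `0` at `t = 0`). -/
def jump {E : Type*} [TopologicalSpace E] [Sub E] (x : ℝ≥0 → E) (t : ℝ≥0) : E :=
  x t - Function.leftLim x t

/-- `n`-dimensional Lévy processes with respect to a filtration. -/
structure IsLevyProcess {n : ℕ} {Ω : Type*} {mΩ : MeasurableSpace Ω}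
    (X : ℝ≥0 → Ω → EuclideanSpace ℝ (Fin n)) (ℱ : Filtration ℝ≥0 mΩ) (P : Measure Ω) : Prop where
  /-- `X` is adapted. -/
  adapted : ∀ t, Measurable[ℱ t] (X t)
  /-- `X` starts at `0` almost surely. -/
  zero : ∀ᵐ ω ∂P, X 0 ω = 0
  /-- The increments `X_{t+s} - X_t` are independent of `ℱ_t`. -/
  indep : ∀ s t, Indep
    (MeasurableSpace.comap (fun ω => X (t + s) ω - X t ω) inferInstance) (ℱ t) P
  /-- The increments are stationary: `X_{t+s} - X_t` has the law of `X_s`. -/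
  stationary : ∀ s t, IdentDistrib (fun ω => X (t + s) ω - X t ω) (X s) P P
  /-- `X` is continuous in probability. -/
  continuousInProb : ∀ t, TendstoInMeasure P X (𝓝 t) (X t)

/-- The filtration contains all the null sets of the ambient `σ`-algebra. -/
def ContainsNullSets {Ω : Type*} {mΩ : MeasurableSpace Ω}
    (ℱ : Filtration ℝ≥0 mΩ) (P : Measure Ω) : Prop :=
  ∀ t, ∀ A : Set Ω, MeasurableSet[mΩ] A → P A = 0 → MeasurableSet[ℱ t] A

/-- The jump counting measure `N_t(dx)` of a path: `N_t(B)` is the number of times `s ∈ (0, t]`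
at which the path has a nonzero jump lying in `B`. -/
def jumpMeasure {E : Type*} [TopologicalSpace E] [AddGroup E] [MeasurableSpace E]
    (x : ℝ≥0 → E) (t : ℝ≥0) : Measure E :=
  Measure.sum fun s : {s : ℝ≥0 // 0 < s ∧ s ≤ t ∧ jump x s ≠ 0} => Measure.dirac (jump x s)

/-- The Lévy measure `ν(dx) = 𝔼[N_1(dx)]`. -/
def levyMeasure {n : ℕ} {Ω : Type*} {mΩ : MeasurableSpace Ω}
    (X : ℝ≥0 → Ω → EuclideanSpace ℝ (Fin n)) (P : Measure Ω) :
    Measure (EuclideanSpace ℝ (Fin n)) :=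
  P.bind fun ω => jumpMeasure (fun t => X t ω) 1

/-- The compensated sum `∫_B x (N_t(dx) - t ν(dx)) = ∫_B x N_t(dx) - t ∫_B x ν(dx)`
of the jumps in a set `B` that stays away from `0`. -/
def compensatedJumpSum {n : ℕ} {Ω : Type*} {mΩ : MeasurableSpace Ω}
    (X : ℝ≥0 → Ω → EuclideanSpace ℝ (Fin n)) (P : Measure Ω)
    (B : Set (EuclideanSpace ℝ (Fin n))) (t : ℝ≥0) (ω : Ω) : EuclideanSpace ℝ (Fin n) :=
  (∫ x in B, x ∂(jumpMeasure (fun s => X s ω) t)) - (t : ℝ) • ∫ x in B, x ∂(levyMeasure X P)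

/-- The process `Z` is (a version of) the stochastic integral
`Z_t = ∫_{|x| ≤ 1} x (N_t(dx) - t ν(dx))`: a càdlàg square-integrable martingale such that, for
every `t`, `Z_t` is the limit in `L²(P)` of the compensated sums of the jumps of size in `(ε, 1]`
as `ε ↓ 0`. -/
structure IsCompensatedSmallJumpIntegral {n : ℕ} {Ω : Type*} {mΩ : MeasurableSpace Ω}
    (Z X : ℝ≥0 → Ω → EuclideanSpace ℝ (Fin n)) (ℱ : Filtration ℝ≥0 mΩ) (P : Measure Ω) :
    Prop where
  martingale : Martingale Z ℱ P
  cadlag : ∀ ω, IsCadlag fun t => Z t ω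
  memLp : ∀ t, MemLp (Z t) 2 P
  tendsto : ∀ t, Tendsto
    (fun ε : ℝ => eLpNorm (fun ω => compensatedJumpSum X P {x | ε < ‖x‖ ∧ ‖x‖ ≤ 1} t ω - Z t ω) 2 P)
    (𝓝[>] 0) (𝓝 0)

end

end LevyIto

/-! The discontinuous part is built from compensated sums of the jumps in shells `δ < |x| ≤ 1`, the
continuous part is what remains of `X`, and everything rests on second moments.

Square integrability comes from the bounded jumps. The increments over a fine grid are at most 2
with probability close to one, so by a first-passage argument and independence the tail of the
running maximum satisfies `G(a + b + 2) ≤ G(b / 2) G(a)` and decays geometrically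
(`IsLevyProcess.memLp_two`). As `X` is centred with stationary independent increments, `E|X_t|²` is
additive in `t`, hence linear.

The law of the jumps is read off from small increments. If `f` is continuous and vanishes near 0,
its sum over the increments along a grid of mesh `h / m` converges pathwise to its sum over the
jumps (`IsCadlag.tendsto_gridSum`). If `f` is also bounded, `|f| ≤ const · |y|²`, so linearity of
the second moment bounds these grid sums in `L²` uniformly in `m`. In the limit, the jump sum over
`(0, t]` has mean `t ∫ f dν` and variance at most `t ∫ f² dν`
(`IsCentredLevyProcess.variance_jumpSum_le`). The same comparison gives `∫ min(|y|², 1) dν ≤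
E|X_1|²` (`IsCentredLevyProcess.lintegral_sq_lt_top`). Pointwise limits of test functions extend the
moment formulas to shells.

The compensated shell sums are therefore martingales, and two of them, with cutoffs `a ≤ b ≤ 1`,
differ at time `t` by at most `t ∫_{0<|y|≤b} |y|² dν` in squared `L²` norm. Along quickly decreasing
cutoffs, Doob's inequality and Borel–Cantelli give almost sure convergence, locally uniform in time.
The difference between `X` and the sum with cutoff `δ_j` has jumps of size at most `δ_j`, so the
limit of these differences is continuous (`continuous_sub_shellLimit`). -/

namespace LevyIto

noncomputable section

/-! ### Càdlàg paths, sums over jumps, and their approximation by increments -/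

section Paths

variable {E F : Type*} [NormedAddCommGroup E] [NormedAddCommGroup F] {x : ℝ≥0 → E}

lemma IsCadlag.tendsto_leftLim (hx : IsCadlag x) (t : ℝ≥0) :
    Tendsto x (𝓝[<] t) (𝓝 (Function.leftLim x t)) :=
  tendsto_leftLim_of_tendsto (hx t).2

/-- Near `s` the path stays close to its left limit before `s` and to its value from `s` on, so the
jump is the only macroscopic contribution to a short increment. -/
lemma IsCadlag.exists_isOpen_norm_sub_lt (hx : IsCadlag x) (s : ℝ≥0) {η : ℝ} (hη : 0 < η) :
    ∃ U : Set ℝ≥0, IsOpen U ∧ s ∈ U ∧ ∀ u ∈ U, ∀ v ∈ U, u ≤ v →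
      (v < s ∨ s ≤ u → ‖x v - x u‖ < η) ∧ (u < s → s ≤ v → ‖x v - x u - jump x s‖ < η) := by
  have h1 : ∀ᶠ u in 𝓝 s, u ∈ Set.Iio s → ‖x u - Function.leftLim x s‖ < η / 2 := by
    rw [← eventually_nhdsWithin_iff]
    have := (hx.tendsto_leftLim s).eventually (Metric.ball_mem_nhds _ (half_pos hη))
    filter_upwards [this] with u hu
    simpa [dist_eq_norm] using hu
  have h2 : ∀ᶠ u in 𝓝 s, u ∈ Set.Ici s → ‖x u - x s‖ < η / 2 := by
    rw [← eventually_nhdsWithin_iff]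
    have := ((hx s).1.tendsto).eventually (Metric.ball_mem_nhds _ (half_pos hη))
    filter_upwards [this] with u hu
    simpa [dist_eq_norm] using hu
  obtain ⟨U, hU, hUo, hsU⟩ := eventually_nhds_iff.1 (h1.and h2)
  refine ⟨U, hUo, hsU, fun u hu v hv huv => ⟨?_, fun hus hsv => ?_⟩⟩
  · rintro (hvs | hsu)
    · have a := (hU u hu).1 (huv.trans_lt hvs)
      have b := (hU v hv).1 hvs
      calc ‖x v - x u‖ = ‖(x v - Function.leftLim x s) - (x u - Function.leftLim x s)‖ := by
            congr 1; abel
        _ ≤ _ := norm_sub_le _ _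
        _ < η := by linarith
    · have a := (hU u hu).2 hsu
      have b := (hU v hv).2 (hsu.trans huv)
      calc ‖x v - x u‖ = ‖(x v - x s) - (x u - x s)‖ := by congr 1; abel
        _ ≤ _ := norm_sub_le _ _
        _ < η := by linarith
  · have a := (hU u hu).1 hus
    have b := (hU v hv).2 hsv
    calc ‖x v - x u - jump x s‖ = ‖(x v - x s) - (x u - Function.leftLim x s)‖ := by
          congr 1; simp only [jump]; abel
      _ ≤ _ := norm_sub_le _ _
      _ < η := by linarith

lemma IsCadlag.norm_jump_le (hx : IsCadlag x) {r : ℝ≥0} {η : ℝ} (hη : 0 ≤ η)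
    (h : ∀ᶠ u in 𝓝[<] r, ‖x r - x u‖ ≤ η) : ‖jump x r‖ ≤ η := by
  rcases eq_or_neBot (𝓝[<] r) with h' | h'
  -- With no points to the left, `Function.leftLim` is by convention the value itself and the jump
  -- is 0.
  · simpa [jump, leftLim_eq_of_eq_bot x h'] using hη
  · exact le_of_tendsto ((tendsto_const_nhds.sub (hx.tendsto_leftLim r)).norm) h

lemma IsCadlag.exists_isOpen_jump_le (hx : IsCadlag x) (s : ℝ≥0) {η : ℝ} (hη : 0 < η) :
    ∃ U : Set ℝ≥0, IsOpen U ∧ s ∈ U ∧ (∀ u ∈ U, ∀ v ∈ U, u ≤ v →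
      (v < s ∨ s ≤ u → ‖x v - x u‖ < η) ∧ (u < s → s ≤ v → ‖x v - x u - jump x s‖ < η)) ∧
      ∀ r ∈ U, r ≠ s → ‖jump x r‖ ≤ η := by
  obtain ⟨U, hU, hs, h⟩ := hx.exists_isOpen_norm_sub_lt s hη
  refine ⟨U, hU, hs, h, fun r hr hrs => hx.norm_jump_le hη.le ?_⟩
  rcases lt_or_gt_of_ne hrs with hlt | hgt
  · filter_upwards [mem_nhdsWithin_of_mem_nhds (hU.mem_nhds hr), self_mem_nhdsWithin] with u hu hur
    exact ((h u hu r hr (le_of_lt hur)).1 (Or.inl hlt)).le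
  · filter_upwards [mem_nhdsWithin_of_mem_nhds (hU.mem_nhds hr), self_mem_nhdsWithin,
      mem_nhdsWithin_of_mem_nhds (Ioi_mem_nhds hgt)] with u hu hur hsu
    exact ((h u hu r hr (le_of_lt hur)).1 (Or.inr (le_of_lt hsu))).le

/-- Each point has a neighbourhood in which it alone can carry a jump exceeding `η`; finitely many
such neighbourhoods cover the compact interval. -/
lemma IsCadlag.finite_jump (hx : IsCadlag x) (a b : ℝ≥0) {η : ℝ} (hη : 0 < η) :
    {s ∈ Set.Icc a b | η < ‖jump x s‖}.Finite := by
  choose U hUo hsU _ hU using fun s => hx.exists_isOpen_jump_le s hη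
  obtain ⟨t, -, ht⟩ := (isCompact_Icc (a := a) (b := b)).elim_nhds_subcover U
    fun s _ => (hUo s).mem_nhds (hsU s)
  refine t.finite_toSet.subset fun s hs => ?_
  obtain ⟨i, hi, hsi⟩ := Set.mem_iUnion₂.1 (ht hs.1)
  by_cases h : s = i
  · exact h ▸ hi
  · exact absurd (hU i s hsi h) (not_le.2 hs.2)

lemma IsCadlag.exists_norm_le (hx : IsCadlag x) (T : ℝ≥0) : ∃ C : ℝ, ∀ t ≤ T, ‖x t‖ ≤ C := by
  have := (isCompact_Icc (a := 0) (b := T)).induction_on (p := fun S => ∃ C : ℝ, ∀ t ∈ S, ‖x t‖ ≤ C)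
    ⟨0, by simp⟩ (fun s t hst ⟨C, hC⟩ => ⟨C, fun u hu => hC u (hst hu)⟩)
    (fun s t ⟨C, hC⟩ ⟨D, hD⟩ => ⟨max C D, fun u hu => hu.elim (fun h => (hC u h).trans (le_max_left _ _))
      (fun h => (hD u h).trans (le_max_right _ _))⟩) (fun s _ => ?_)
  · obtain ⟨C, hC⟩ := this
    exact ⟨C, fun t ht => hC t ⟨zero_le, ht⟩⟩
  · obtain ⟨U, hU, hs, h⟩ := hx.exists_isOpen_norm_sub_lt s one_pos
    refine ⟨U, mem_nhdsWithin_of_mem_nhds (hU.mem_nhds hs), ‖x s‖ + ‖jump x s‖ + 1, fun u hu => ?_⟩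
    rcases lt_or_ge u s with hus | hsu
    · have h1 := (h u hu s hs hus.le).2 hus le_rfl
      have h2 : x u = x s - jump x s - (x s - x u - jump x s) := by abel
      rw [h2]
      linarith [norm_sub_le (x s - jump x s) (x s - x u - jump x s), norm_sub_le (x s) (jump x s)]
    · have h1 := (h s hs u hu hsu).1 (Or.inr le_rfl)
      have h2 : x u = x s + (x u - x s) := by abel
      rw [h2]
      linarith [norm_add_le (x s) (x u - x s), norm_nonneg (jump x s)]

/-- The càdlàg substitute for uniform continuity, from a Lebesgue number of the local
neighbourhoods. The bound is `2 * η` in the first case because the cell may still contain one jump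
of size at most `η`. -/
lemma IsCadlag.exists_pos_modulus (hx : IsCadlag x) (T : ℝ≥0) {η : ℝ} (hη : 0 < η) :
    ∃ δ > 0, ∀ u v, u ≤ v → v ≤ T → dist v u < δ →
      ((∀ r ∈ Set.Ioc u v, ‖jump x r‖ ≤ η) ∧ ‖x v - x u‖ < 2 * η) ∨
      ∃ s ∈ Set.Ioc u v, η < ‖jump x s‖ ∧ (∀ r ∈ Set.Ioc u v, r ≠ s → ‖jump x r‖ ≤ η) ∧
        ‖x v - x u - jump x s‖ < η := by
  choose U hUo hsU hosc hU using fun s => hx.exists_isOpen_jump_le s hη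
  obtain ⟨δ, hδ, hball⟩ := lebesgue_number_lemma_of_metric (isCompact_Icc (a := 0) (b := T)) hUo
    (fun s _ => Set.mem_iUnion.2 ⟨s, hsU s⟩)
  refine ⟨δ, hδ, fun u v huv hvT hd => ?_⟩
  obtain ⟨s, hs⟩ := hball u ⟨zero_le, huv.trans hvT⟩
  have hmem : ∀ r, u ≤ r → r ≤ v → r ∈ U s := fun r h1 h2 => hs (by
    rw [Metric.mem_ball]
    refine lt_of_le_of_lt ?_ hd
    rw [NNReal.dist_eq, NNReal.dist_eq, abs_of_nonneg (sub_nonneg.2 (NNReal.coe_le_coe.2 h1)),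
      abs_of_nonneg (sub_nonneg.2 (NNReal.coe_le_coe.2 huv))]
    exact sub_le_sub_right (NNReal.coe_le_coe.2 h2) _)
  have hu := hmem u le_rfl huv
  have hv := hmem v huv le_rfl
  by_cases hsI : s ∈ Set.Ioc u v
  · have h3 := (hosc s u hu v hv huv).2 hsI.1 hsI.2
    by_cases hj : η < ‖jump x s‖
    · exact Or.inr ⟨s, hsI, hj, fun r hr hrs => hU s r (hmem r hr.1.le hr.2) hrs, h3⟩
    · refine Or.inl ⟨fun r hr => ?_, ?_⟩
      · by_cases hrs : r = s
        · exact hrs ▸ not_lt.1 hj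
        · exact hU s r (hmem r hr.1.le hr.2) hrs
      · have := norm_add_le (x v - x u - jump x s) (jump x s)
        rw [sub_add_cancel] at this
        linarith [not_lt.1 hj]
  · have hside : v < s ∨ s ≤ u := by
      by_contra! h
      exact hsI ⟨h.2, h.1⟩
    refine Or.inl ⟨fun r hr => hU s r (hmem r hr.1.le hr.2) (fun h => hsI (h ▸ hr)), ?_⟩
    linarith [(hosc s u hu v hv huv).1 hside]

/-- The sum of `f` over the jumps of a path in the time interval `(a, b]`. -/
def jumpSum {E F : Type*} [TopologicalSpace E] [Sub E] [AddCommMonoid F] (f : E → F) (x : ℝ≥0 → E) (a b : ℝ≥0) : F := ∑ᶠ s ∈ Set.Ioc a b, f (jump x s)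

lemma IsCadlag.finite_support (hx : IsCadlag x) {f : E → F} {ε : ℝ} (hε : 0 < ε)
    (hf : ∀ y, ‖y‖ < ε → f y = 0) (a b : ℝ≥0) :
    (Set.Ioc a b ∩ Function.support fun s => f (jump x s)).Finite := by
  refine (hx.finite_jump a b (half_pos hε)).subset fun s hs => ⟨Set.Ioc_subset_Icc_self hs.1, ?_⟩
  by_contra h
  exact hs.2 (hf _ (by linarith [not_lt.1 h]))

lemma jumpSum_eq_zero {f : E → F} {a b : ℝ≥0} (h : ∀ r ∈ Set.Ioc a b, f (jump x r) = 0) :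
    jumpSum f x a b = 0 :=
  finsum_mem_eq_zero_of_forall_eq_zero h

lemma jumpSum_eq_single {f : E → F} {a b s : ℝ≥0} (hs : s ∈ Set.Ioc a b)
    (h : ∀ r ∈ Set.Ioc a b, r ≠ s → f (jump x r) = 0) : jumpSum f x a b = f (jump x s) := by
  rw [jumpSum, finsum_eq_single _ s, finsum_eq_if, if_pos hs]
  intro r hr
  rw [finsum_eq_if]
  split_ifs with hr'
  · exact h r hr' hr
  · rfl

lemma jumpSum_self (f : E → F) (x : ℝ≥0 → E) (a : ℝ≥0) : jumpSum f x a a = 0 :=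
  jumpSum_eq_zero (by simp)

lemma IsCadlag.jumpSum_add (hx : IsCadlag x) {f : E → F} {ε : ℝ} (hε : 0 < ε)
    (hf : ∀ y, ‖y‖ < ε → f y = 0) {a b c : ℝ≥0} (hab : a ≤ b) (hbc : b ≤ c) :
    jumpSum f x a b + jumpSum f x b c = jumpSum f x a c := by
  rw [jumpSum, jumpSum, jumpSum, ← Set.Ioc_union_Ioc_eq_Ioc hab hbc,
    finsum_mem_union' (Set.disjoint_left.2 fun s h1 h2 => not_lt.2 h1.2 h2.1)
      (hx.finite_support hε hf a b) (hx.finite_support hε hf b c)]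

lemma IsCadlag.sum_jumpSum (hx : IsCadlag x) {f : E → F} {ε : ℝ} (hε : 0 < ε)
    (hf : ∀ y, ‖y‖ < ε → f y = 0) {t : ℕ → ℝ≥0} (ht : Monotone t) (n : ℕ) :
    ∑ k ∈ Finset.range n, jumpSum f x (t k) (t (k + 1)) = jumpSum f x (t 0) (t n) := by
  induction n with
  | zero => simp [jumpSum_self]
  | succ n ih =>
    rw [Finset.sum_range_succ, ih, hx.jumpSum_add hε hf (ht n.zero_le) (ht n.le_succ)]

/-- Sums of `f` over the increments of a path along the uniform grid of `[a, a + h]`. -/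
def gridSum (f : E → F) (x : ℝ≥0 → E) (a h : ℝ≥0) (m : ℕ) : F :=
  ∑ k ∈ Finset.range m, f (x (a + (k + 1 : ℕ) * (h / m)) - x (a + (k : ℕ) * (h / m)))

/-- On a fine grid a cell holds at most one large jump and its increment is close to that jump; the
other cells have increments too small for `f` to see. This is the bridge from the law of small
increments to the law of the jumps. -/
lemma IsCadlag.tendsto_gridSum (hx : IsCadlag x) {f : E → F} (hfc : Continuous f) {ε : ℝ}
    (hε : 0 < ε) (hf : ∀ y, ‖y‖ < ε → f y = 0) (a h : ℝ≥0) :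
    Tendsto (gridSum f x a h) atTop (𝓝 (jumpSum f x a (a + h))) := by
  classical
  -- The jump sum of `c` counts the jumps exceeding `ε / 2`. A cell error of at most `κ` times its
  -- count adds up to a bound independent of the number of cells.
  let c : E → ℝ := fun y => if ε / 2 < ‖y‖ then 1 else 0
  have hc : ∀ y, ‖y‖ < ε / 2 → c y = 0 := fun y hy => if_neg (not_lt.2 hy.le)
  have hc0 : ∀ y, 0 ≤ c y := fun y => by simp only [c]; split_ifs <;> norm_num
  have hJ := hx.finite_jump a (a + h) (half_pos hε)
  rw [Metric.tendsto_atTop]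
  intro κ' hκ'
  obtain ⟨κ, hκ, hκN⟩ : ∃ κ > 0, κ * jumpSum c x a (a + h) < κ' := by
    have h0 : 0 ≤ jumpSum c x a (a + h) := finsum_nonneg fun s => finsum_nonneg fun _ => hc0 _
    refine ⟨κ' / (jumpSum c x a (a + h) + 1), by positivity, ?_⟩
    rw [div_mul_eq_mul_div, div_lt_iff₀ (by positivity)]
    nlinarith
  -- a common modulus of continuity of `f` at the large jumps
  have hη : ∃ η > 0, η < ε / 2 ∧ ∀ s ∈ {s ∈ Set.Icc a (a + h) | ε / 2 < ‖jump x s‖}, ∀ y,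
      ‖y - jump x s‖ < η → ‖f y - f (jump x s)‖ < κ := by
    have : ∀ᶠ η in 𝓝[>] (0 : ℝ), ∀ s ∈ {s ∈ Set.Icc a (a + h) | ε / 2 < ‖jump x s‖}, ∀ y,
      ‖y - jump x s‖ < η → ‖f y - f (jump x s)‖ < κ := by
      rw [hJ.eventually_all]
      intro s hs
      obtain ⟨δ, hδ, hδf⟩ := Metric.continuous_iff.1 hfc (jump x s) κ hκ
      filter_upwards [mem_nhdsWithin_of_mem_nhds (Iio_mem_nhds hδ)] with η hη y hy
      rw [← dist_eq_norm]
      exact hδf y (by rw [dist_eq_norm]; exact hy.trans hη)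
    have h2 : ∀ᶠ η in 𝓝[>] (0 : ℝ), η < ε / 2 :=
      mem_nhdsWithin_of_mem_nhds (Iio_mem_nhds (half_pos hε))
    have h3 : ∀ᶠ η in 𝓝[>] (0 : ℝ), 0 < η := self_mem_nhdsWithin
    obtain ⟨η, h1, h2, h3⟩ := (this.and (h2.and h3)).exists
    exact ⟨η, h3, h2, h1⟩
  obtain ⟨η, hη0, hηε, hηf⟩ := hη
  obtain ⟨δ, hδ, hmod⟩ := hx.exists_pos_modulus (a + h) hη0
  -- Since `η < ε / 2`, increments below `2 * η`, or within `η` of a jump of size at most `ε / 2`,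
  -- lie in the ball where `f` vanishes. Only cells with a jump above `ε / 2` contribute an error.
  have hcell : ∀ u v, a ≤ u → u ≤ v → v ≤ a + h → dist v u < δ →
      ‖f (x v - x u) - jumpSum f x u v‖ ≤ κ * jumpSum c x u v := by
    intro u v hau huv hv hd
    rcases hmod u v huv hv hd with ⟨h1, h2⟩ | ⟨s, hs, hsj, hr, hsd⟩
    · rw [jumpSum_eq_zero fun r hr => hf _ (by linarith [h1 r hr]),
        jumpSum_eq_zero fun r hr => hc _ (by linarith [h1 r hr]), hf _ (by linarith)]
      simp
    · rw [jumpSum_eq_single hs fun r hr' hrs => hf _ (by linarith [hr r hr' hrs]),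
        jumpSum_eq_single hs fun r hr' hrs => hc _ (by linarith [hr r hr' hrs])]
      by_cases hbig : ε / 2 < ‖jump x s‖
      · have := hηf s ⟨⟨hau.trans hs.1.le, hs.2.trans hv⟩, hbig⟩ _ hsd
        simp only [c, if_pos hbig, mul_one]
        exact this.le
      · have h4 := norm_add_le (x v - x u - jump x s) (jump x s)
        rw [sub_add_cancel] at h4
        rw [hf _ (by linarith [not_lt.1 hbig]), hf _ (by linarith [not_lt.1 hbig])]
        simpa using mul_nonneg hκ.le (hc0 _)
  obtain ⟨M, hM⟩ := exists_nat_gt ((h : ℝ) / δ)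
  refine ⟨M + 1, fun m hm => ?_⟩
  have hm0 : (0 : ℝ) < m := by exact_mod_cast (Nat.succ_pos M).trans_le hm
  have hmesh : (h : ℝ) / m < δ := by
    rw [div_lt_iff₀ hm0]
    rw [div_lt_iff₀ hδ] at hM
    have : (M : ℝ) ≤ m := by exact_mod_cast (Nat.le_succ M).trans hm
    nlinarith
  have htop : ((m : ℕ) : ℝ≥0) * (h / m) = h := by
    rw [mul_div_cancel₀]
    exact_mod_cast hm0.ne'
  let t : ℕ → ℝ≥0 := fun k => a + (k : ℕ) * (h / m)
  have htm : Monotone t := fun i j hij => by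
    simp only [t]; gcongr
  have ht0 : t 0 = a := by simp [t]
  have ht1 : t m = a + h := by simp only [t, htop]
  have e1 := hx.sum_jumpSum hε hf htm m
  have e2 := hx.sum_jumpSum (half_pos hε) hc htm m
  rw [ht0, ht1] at e1 e2
  rw [dist_eq_norm, ← e1, gridSum, ← Finset.sum_sub_distrib]
  refine (norm_sum_le _ _).trans_lt (lt_of_le_of_lt ?_ hκN)
  rw [← e2, Finset.mul_sum]
  refine Finset.sum_le_sum fun k hk => hcell (t k) (t (k + 1)) (ht0 ▸ htm k.zero_le) (htm k.le_succ)
    (ht1 ▸ htm (Finset.mem_range.1 hk)) ?_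
  have : dist (t (k + 1)) (t k) = (h : ℝ) / m := by
    rw [NNReal.dist_eq]
    simp only [t]
    push_cast
    rw [show (a : ℝ) + (k + 1) * (h / m) - (a + k * (h / m)) = h / m by ring]
    exact abs_of_nonneg (by positivity)
  rw [this]
  exact hmesh

/-- Jumps visible to `f` are isolated, so near `t` the jump sum can change only by the jump at `t`
itself. -/
lemma IsCadlag.eventually_jumpSum (hx : IsCadlag x) {f : E → F} {ε : ℝ} (hε : 0 < ε)
    (hf : ∀ y, ‖y‖ < ε → f y = 0) (t : ℝ≥0) :
    ∀ᶠ v in 𝓝 t, (t ≤ v → jumpSum f x 0 v = jumpSum f x 0 t) ∧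
      (v < t → jumpSum f x 0 t = jumpSum f x 0 v + f (jump x t)) := by
  obtain ⟨U, hU, ht, -, hj⟩ := hx.exists_isOpen_jump_le t (half_pos hε)
  obtain ⟨δ, hδ, hball⟩ := Metric.isOpen_iff.1 hU t ht
  filter_upwards [Metric.ball_mem_nhds t hδ] with v hv
  rw [Metric.mem_ball, NNReal.dist_eq, abs_lt] at hv
  refine ⟨fun htv => ?_, fun hvt => ?_⟩
  · rw [← hx.jumpSum_add hε hf zero_le htv, jumpSum_eq_zero (a := t), add_zero]
    intro r hr
    refine hf _ (lt_of_le_of_lt (hj r (hball ?_) hr.1.ne') (half_lt_self hε))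
    have h1 : (t : ℝ) < r := hr.1
    have h2 : (r : ℝ) ≤ v := hr.2
    rw [Metric.mem_ball, NNReal.dist_eq, abs_lt]
    constructor <;> linarith
  · rw [← hx.jumpSum_add hε hf zero_le hvt.le, jumpSum_eq_single (a := v) ⟨hvt, le_rfl⟩]
    intro r hr hrt
    refine hf _ (lt_of_le_of_lt (hj r (hball ?_) hrt) (half_lt_self hε))
    have h1 : (v : ℝ) < r := hr.1
    have h2 : (r : ℝ) ≤ t := hr.2
    rw [Metric.mem_ball, NNReal.dist_eq, abs_lt]
    constructor <;> linarith

lemma IsCadlag.tsum_jump {M : Type*} [AddCommMonoid M] [TopologicalSpace M] (hx : IsCadlag x)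
    {g : E → M} {ε : ℝ} (hε : 0 < ε) (hg0 : ∀ y, ‖y‖ < ε → g y = 0) (t : ℝ≥0) :
    ∑' s : {s : ℝ≥0 // 0 < s ∧ s ≤ t ∧ jump x s ≠ 0}, g (jump x s) = jumpSum g x 0 t := by
  have key : ∀ s, ({s : ℝ≥0 | 0 < s ∧ s ≤ t ∧ jump x s ≠ 0}.indicator fun s => g (jump x s)) s =
      ∑ᶠ _ : s ∈ Set.Ioc 0 t, g (jump x s) := fun s => by
    rw [finsum_eq_if]
    by_cases h0 : jump x s = 0
    · simp [h0, hg0 0 (by simpa using hε)]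
    · split_ifs with h
      · have hs : s ∈ {s : ℝ≥0 | 0 < s ∧ s ≤ t ∧ jump x s ≠ 0} := ⟨h.1, h.2, h0⟩
        exact Set.indicator_of_mem hs _
      · exact Set.indicator_of_notMem (fun h' => h ⟨h'.1, h'.2.1⟩) _
  refine (tsum_subtype {s : ℝ≥0 | 0 < s ∧ s ≤ t ∧ jump x s ≠ 0} (fun s => g (jump x s))).trans ?_
  rw [tsum_eq_finsum, jumpSum]
  · exact finsum_congr key
  · refine (hx.finite_jump 0 t (half_pos hε)).subset fun s hs => ?_
    rw [Function.mem_support, Set.indicator_apply_ne_zero] at hs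
    refine ⟨⟨hs.1.1.le, hs.1.2.1⟩, ?_⟩
    by_contra h
    exact hs.2 (hg0 _ (by linarith [not_lt.1 h]))

lemma IsCadlag.lintegral_jumpMeasure [MeasurableSpace E] (hx : IsCadlag x) {g : E → ℝ≥0∞}
    (hg : Measurable g) {ε : ℝ} (hε : 0 < ε) (hg0 : ∀ y, ‖y‖ < ε → g y = 0) (t : ℝ≥0) :
    ∫⁻ y, g y ∂(jumpMeasure x t) = jumpSum g x 0 t := by
  rw [jumpMeasure, lintegral_sum_measure, ← hx.tsum_jump hε hg0 t]
  exact tsum_congr fun s => lintegral_dirac' _ hg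

lemma IsCadlag.integrable_jumpMeasure [MeasurableSpace E] (hx : IsCadlag x) {g : E → F}
    (hg : StronglyMeasurable g) {ε : ℝ} (hε : 0 < ε) (hg0 : ∀ y, ‖y‖ < ε → g y = 0) (t : ℝ≥0) :
    Integrable g (jumpMeasure x t) := by
  have hg0' : ∀ y, ‖y‖ < ε → ‖g y‖ₑ = 0 := fun y hy => by simp [hg0 y hy]
  refine ⟨hg.aestronglyMeasurable, ?_⟩
  have hfin := hx.finite_support hε (f := g) hg0 0 t
  rw [HasFiniteIntegral, hx.lintegral_jumpMeasure hg.enorm hε hg0', jumpSum,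
    finsum_mem_eq_sum_of_inter_support_eq (t := hfin.toFinset) _ (by ext; simp)]
  exact ENNReal.sum_lt_top.2 fun _ _ => enorm_lt_top

lemma IsCadlag.integral_jumpMeasure [NormedSpace ℝ F] [CompleteSpace F] [MeasurableSpace E]
    (hx : IsCadlag x) {g : E → F} (hg : StronglyMeasurable g) {ε : ℝ} (hε : 0 < ε)
    (hg0 : ∀ y, ‖y‖ < ε → g y = 0) (t : ℝ≥0) :
    ∫ y, g y ∂(jumpMeasure x t) = jumpSum g x 0 t := by
  have h := hx.integrable_jumpMeasure hg hε hg0 t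
  rw [jumpMeasure] at h ⊢
  rw [← (hasSum_integral_measure h).tsum_eq, ← hx.tsum_jump hε hg0 t]
  exact tsum_congr fun s => integral_dirac' _ _ hg

end Paths

/-! ### Independence of the future increments from the past -/

section Independence

/-- It suffices to test on the π-system of intersections `s ∩ t`, where splitting off `t` first and
then separating `s` from `u` factorises the probability. -/
lemma indep_sup_of_indep {Ω : Type*} {m₁ m₂ m₃ mΩ : MeasurableSpace Ω} {P : Measure Ω}
    [IsProbabilityMeasure P] (h₁ : m₁ ≤ mΩ) (h₂ : m₂ ≤ mΩ) (h₃ : m₃ ≤ mΩ) (h : Indep m₁ m₂ P)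
    (h' : Indep m₃ (m₁ ⊔ m₂) P) : Indep (m₁ ⊔ m₃) m₂ P := by
  let p : Set (Set Ω) := Set.image2 (· ∩ ·) {s | MeasurableSet[m₁] s} {s | MeasurableSet[m₃] s}
  have hp : IsPiSystem p := by
    rintro _ ⟨s, hs, t, ht, rfl⟩ _ ⟨s', hs', t', ht', rfl⟩ -
    exact ⟨s ∩ s', MeasurableSet.inter hs hs', t ∩ t', MeasurableSet.inter ht ht',
      Set.inter_inter_inter_comm _ _ _ _⟩
  have hgen : m₁ ⊔ m₃ = MeasurableSpace.generateFrom p := by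
    apply le_antisymm
    · refine sup_le (fun s hs => ?_) (fun s hs => ?_)
      · exact MeasurableSpace.measurableSet_generateFrom
          ⟨s, hs, Set.univ, MeasurableSet.univ, Set.inter_univ _⟩
      · exact MeasurableSpace.measurableSet_generateFrom
          ⟨Set.univ, MeasurableSet.univ, s, hs, Set.univ_inter _⟩
    · refine MeasurableSpace.generateFrom_le ?_
      rintro _ ⟨s, hs, t, ht, rfl⟩
      exact MeasurableSet.inter ((le_sup_left : m₁ ≤ m₁ ⊔ m₃) _ hs)
        ((le_sup_right : m₃ ≤ m₁ ⊔ m₃) _ ht)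
  refine IndepSets.indep (sup_le h₁ h₃) h₂ hp (@MeasurableSpace.isPiSystem_measurableSet Ω m₂) hgen
    (@MeasurableSpace.generateFrom_measurableSet Ω m₂).symm ?_
  rw [IndepSets_iff]
  rintro _ u ⟨s, hs, t, ht, rfl⟩ hu
  rw [Indep_iff] at h h'
  have e1 := h' t (s ∩ u) ht (MeasurableSet.inter ((le_sup_left : m₁ ≤ m₁ ⊔ m₂) _ hs)
    ((le_sup_right : m₂ ≤ m₁ ⊔ m₂) _ hu))
  have e2 := h' t s ht ((le_sup_left : m₁ ≤ m₁ ⊔ m₂) _ hs)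
  have e3 := h s u hs hu
  change P (s ∩ t ∩ u) = P (s ∩ t) * P u
  rw [Set.inter_comm s t, Set.inter_assoc, e1, e2, e3, mul_assoc]

variable {n : ℕ} {Ω : Type*} {mΩ : MeasurableSpace Ω} {P : Measure Ω}
  {ℱ : Filtration ℝ≥0 mΩ} {X : ℝ≥0 → Ω → EuclideanSpace ℝ (Fin n)}

/-- The `σ`-algebra generated by the increments of `X` after time `s`. -/
@[reducible]
def futureIncrements (X : ℝ≥0 → Ω → EuclideanSpace ℝ (Fin n)) (s : ℝ≥0) : MeasurableSpace Ω :=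
  ⨆ u, MeasurableSpace.comap (fun ω => X (s + u) ω - X s ω) inferInstance

lemma IsLevyProcess.measurable (hX : IsLevyProcess X ℱ P) (t : ℝ≥0) : Measurable (X t) :=
  (hX.adapted t).mono (ℱ.le t) le_rfl

lemma IsLevyProcess.comap_le (hX : IsLevyProcess X ℱ P) {s u t : ℝ≥0} (h : s + u ≤ t) :
    MeasurableSpace.comap (fun ω => X (s + u) ω - X s ω) inferInstance ≤ ℱ t :=
  Measurable.comap_le (m₁ := ℱ t) (((hX.adapted _).mono (ℱ.mono h) le_rfl).sub
    ((hX.adapted _).mono (ℱ.mono (le_self_add.trans h)) le_rfl))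

lemma IsLevyProcess.futureIncrements_le (hX : IsLevyProcess X ℱ P) (s : ℝ≥0) :
    futureIncrements X s ≤ mΩ :=
  iSup_le fun _ => (hX.comap_le le_rfl).trans (ℱ.le _)

lemma measurable_futureIncrements (X : ℝ≥0 → Ω → EuclideanSpace ℝ (Fin n)) {s u v : ℝ≥0}
    (hu : s ≤ u) (hv : s ≤ v) :
    Measurable[futureIncrements X s] (fun ω => X v ω - X u ω) := by
  have key : ∀ w, s ≤ w → Measurable[futureIncrements X s] (fun ω => X w ω - X s ω) := by
    intro w hw
    obtain ⟨w, rfl⟩ := exists_add_of_le hw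
    exact (comap_measurable _).mono
      (le_iSup (fun u => MeasurableSpace.comap (fun ω => X (s + u) ω - X s ω) inferInstance) w)
      le_rfl
  have := (key v hv).sub (key u hu)
  convert this using 1
  ext1 ω
  simp

/-- Finitely many times are added in increasing order: the newest increment is independent of a
σ-algebra of the filtration that already contains `ℱ s` and the earlier increments. A directed
supremum then covers all times. -/
lemma IsLevyProcess.indep_futureIncrements [IsProbabilityMeasure P] (hX : IsLevyProcess X ℱ P)
    (s : ℝ≥0) : Indep (futureIncrements X s) (ℱ s) P := by
  classical
  let m : Finset ℝ≥0 → MeasurableSpace Ω := fun I =>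
    ⨆ u ∈ I, MeasurableSpace.comap (fun ω => X (s + u) ω - X s ω) inferInstance
  have hm_le : ∀ (I : Finset ℝ≥0) t, (∀ u ∈ I, s + u ≤ t) → m I ≤ ℱ t := fun I t h =>
    iSup₂_le fun u hu => hX.comap_le (h u hu)
  have hmono : Monotone m := fun I J h => biSup_mono fun u hu => h hu
  have hle : ∀ I, m I ≤ mΩ := fun I => (iSup₂_le fun u _ => (hX.comap_le le_rfl).trans (ℱ.le _))
  have hind : ∀ I, Indep (m I) (ℱ s) P := by
    intro I
    induction I using Finset.induction_on_max with
    | empty => simpa [m] using indep_bot_left _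
    | insert a I hI ih =>
      -- `b` is the last time already treated, or 0 if there is none, in which case the increment up
      -- to `b` vanishes.
      obtain ⟨b, hba, hIb, hb⟩ : ∃ b ≤ a, (∀ u ∈ I, u ≤ b) ∧
          Measurable[m I] (fun ω => X (s + b) ω - X s ω) := by
        rcases I.eq_empty_or_nonempty with rfl | hne
        · exact ⟨0, zero_le, by simp, by simp⟩
        · refine ⟨I.max' hne, (hI _ (I.max'_mem hne)).le, fun u hu => I.le_max' u hu, ?_⟩
          exact (comap_measurable _).mono (le_iSup₂ (f := fun u (_ : u ∈ I) =>
            MeasurableSpace.comap (fun ω => X (s + u) ω - X s ω) inferInstance) _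
            (I.max'_mem hne)) le_rfl
      obtain ⟨c, rfl⟩ := exists_add_of_le hba
      have hi := hX.indep c (s + b)
      have hle3 : MeasurableSpace.comap (fun ω => X (s + b + c) ω - X (s + b) ω) inferInstance ≤ mΩ :=
        (hX.comap_le le_rfl).trans (ℱ.le _)
      have h4 := indep_sup_of_indep (hle I) (ℱ.le s) hle3 ih
        (indep_of_indep_of_le_right hi (sup_le (hm_le I _ fun u hu => by gcongr; exact hIb u hu)
          (ℱ.mono le_self_add)))
      refine indep_of_indep_of_le_left h4 (iSup₂_le fun u hu => ?_)
      rcases Finset.mem_insert.1 hu with rfl | hu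
      · refine Measurable.comap_le (m₁ := _) ?_
        have h5 : Measurable[m I ⊔ MeasurableSpace.comap
            (fun ω => X (s + b + c) ω - X (s + b) ω) inferInstance]
            (fun ω => (X (s + b + c) ω - X (s + b) ω) + (X (s + b) ω - X s ω)) :=
          ((comap_measurable _).mono le_sup_right le_rfl).add (hb.mono le_sup_left le_rfl)
        simpa [add_assoc] using h5
      · exact (le_iSup₂ (f := fun u (_ : u ∈ I) =>
            MeasurableSpace.comap (fun ω => X (s + u) ω - X s ω) inferInstance) u hu).trans
            le_sup_left
  have := indep_iSup_of_directed_le hind hle (ℱ.le s) hmono.directed_le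
  refine indep_of_indep_of_le_left this (iSup_le fun u => ?_)
  exact (le_iSup₂ (f := fun v (_ : v ∈ ({u} : Finset ℝ≥0)) =>
    MeasurableSpace.comap (fun ω => X (s + v) ω - X s ω) inferInstance) u (by simp)).trans
    (le_iSup m {u})

end Independence

/-! ### Measurability of jump sums and of the jump measure -/

section Measurability

variable {E F : Type*} [NormedAddCommGroup E] [NormedAddCommGroup F]

lemma IsCadlag.finite_jump_Ioc {x : ℝ≥0 → E} (hx : IsCadlag x) (a b : ℝ≥0) {η : ℝ} (hη : 0 < η) :
    {s ∈ Set.Ioc a b | η < ‖jump x s‖}.Finite :=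
  (hx.finite_jump a b hη).subset fun _ hs => ⟨Set.Ioc_subset_Icc_self hs.1, hs.2⟩

lemma IsCadlag.jumpSum_eq_sum {M : Type*} [AddCommMonoid M] {x : ℝ≥0 → E} (hx : IsCadlag x)
    {φ : E → M} {ε : ℝ} (hε : 0 < ε) (hφ : ∀ y, ‖y‖ < ε → φ y = 0) (a b : ℝ≥0) :
    jumpSum φ x a b = ∑ s ∈ (hx.finite_jump_Ioc a b (half_pos hε)).toFinset, φ (jump x s) := by
  refine finsum_mem_eq_sum_of_inter_support_eq _ ?_
  ext s
  simp only [Set.mem_inter_iff, Function.mem_support, Set.Finite.coe_toFinset, Set.mem_ofPred_eq]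
  refine ⟨fun h => ⟨⟨h.1, ?_⟩, h.2⟩, fun h => ⟨h.1.1, h.2⟩⟩
  by_contra h'
  exact h.2 (hφ _ (by linarith [not_lt.1 h']))

lemma IsCadlag.jumpSum_sub {x : ℝ≥0 → E} (hx : IsCadlag x) {f g : E → F} {ε : ℝ} (hε : 0 < ε)
    (hf : ∀ y, ‖y‖ < ε → f y = 0) (hg : ∀ y, ‖y‖ < ε → g y = 0) (a b : ℝ≥0) :
    jumpSum (fun y => f y - g y) x a b = jumpSum f x a b - jumpSum g x a b := by
  rw [hx.jumpSum_eq_sum hε hf, hx.jumpSum_eq_sum hε hg,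
    hx.jumpSum_eq_sum hε fun y hy => by rw [hf y hy, hg y hy, sub_zero], Finset.sum_sub_distrib]

lemma jumpSum_nonneg {f : E → ℝ} (hf : ∀ y, 0 ≤ f y) (x : ℝ≥0 → E) (a b : ℝ≥0) :
    0 ≤ jumpSum f x a b :=
  finsum_nonneg fun _ => finsum_nonneg fun _ => hf _

lemma IsCadlag.tendsto_jumpSum {x : ℝ≥0 → E} (hx : IsCadlag x) {g : ℕ → E → F} {f : E → F} {ε : ℝ}
    (hε : 0 < ε) (hg : ∀ j y, ‖y‖ < ε → g j y = 0)
    (hgf : ∀ y, Tendsto (fun j => g j y) atTop (𝓝 (f y))) (a b : ℝ≥0) :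
    Tendsto (fun j => jumpSum (g j) x a b) atTop (𝓝 (jumpSum f x a b)) := by
  have hf : ∀ y, ‖y‖ < ε → f y = 0 := fun y hy =>
    tendsto_nhds_unique (hgf y) (by simp [hg _ y hy])
  simp_rw [hx.jumpSum_eq_sum hε (hg _)]
  rw [hx.jumpSum_eq_sum hε hf]
  exact tendsto_finsetSum _ fun s _ => hgf _

variable {n : ℕ} {Ω : Type*} {mΩ : MeasurableSpace Ω} {P : Measure Ω}
  {ℱ : Filtration ℝ≥0 mΩ} {X : ℝ≥0 → Ω → EuclideanSpace ℝ (Fin n)}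
  [MeasurableSpace F] [BorelSpace F] [SecondCountableTopology F]

lemma measurable_gridSum {m : MeasurableSpace Ω} {f : EuclideanSpace ℝ (Fin n) → F}
    (hf : Continuous f) {a h : ℝ≥0}
    (hm : ∀ u v, a ≤ u → u ≤ v → v ≤ a + h → Measurable[m] fun ω => X v ω - X u ω) (N : ℕ) :
    Measurable[m] fun ω => gridSum f (fun t => X t ω) a h N := by
  refine Finset.measurable_fun_sum _ fun k hk => hf.measurable.comp (hm _ _ le_self_add ?_ ?_)
  · gcongr; simp
  · have hk' : k + 1 ≤ N := Finset.mem_range.1 hk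
    gcongr
    calc ((k + 1 : ℕ) : ℝ≥0) * (h / N) ≤ N * (h / N) := by gcongr
      _ = h := mul_div_cancel₀ _ (by
        have : N ≠ 0 := by omega
        exact_mod_cast this)

/-- The σ-algebra `m` is left free so that one argument yields adaptedness (`m = ℱ t`) as well as
independence of the past (`m = futureIncrements X s`). -/
lemma measurable_jumpSum (hc : ∀ ω, IsCadlag fun t => X t ω) {m : MeasurableSpace Ω}
    {f : EuclideanSpace ℝ (Fin n) → F} (hf : Continuous f) {ε : ℝ} (hε : 0 < ε)
    (hf0 : ∀ y, ‖y‖ < ε → f y = 0) {a b : ℝ≥0} (hab : a ≤ b)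
    (hm : ∀ u v, a ≤ u → u ≤ v → v ≤ b → Measurable[m] fun ω => X v ω - X u ω) :
    Measurable[m] fun ω => jumpSum f (fun t => X t ω) a b := by
  obtain ⟨h, rfl⟩ := exists_add_of_le hab
  exact measurable_of_tendsto_metrizable (measurable_gridSum hf hm)
    (tendsto_pi_nhds.2 fun ω => (hc ω).tendsto_gridSum hf hε hf0 a h)

/-- Needed to integrate against `levyMeasure`, which is a `Measure.bind`. Open sets away from 0 have
indicators that are limits of continuous functions; the π-system of open sets handles the finite
restrictions to `V j`, and the origin carries no mass. -/
lemma measurable_jumpMeasure (hXm : ∀ t, Measurable (X t)) (hc : ∀ ω, IsCadlag fun t => X t ω)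
    (t : ℝ≥0) : Measurable fun ω => jumpMeasure (fun s => X s ω) t := by
  have hopen : ∀ (W : Set (EuclideanSpace ℝ (Fin n))) (ε : ℝ), IsOpen W → 0 < ε →
      (∀ y ∈ W, ε ≤ ‖y‖) → (Measurable fun ω => jumpMeasure (fun s => X s ω) t W) ∧
        ∀ ω, jumpMeasure (fun s => X s ω) t W < ∞ := by
    intro W ε hW hε hWε
    have h0 : (0 : EuclideanSpace ℝ (Fin n)) ∈ Wᶜ := fun h => by
      have := hWε 0 h
      simp only [norm_zero] at this
      linarith
    let g : ℕ → EuclideanSpace ℝ (Fin n) → ℝ := fun j y => min 1 (j * Metric.infDist y Wᶜ)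
    have hgc : ∀ j, Continuous (g j) := fun j =>
      continuous_const.min (continuous_const.mul (Metric.continuous_infDist_pt _))
    have hgW : ∀ j, ∀ y ∉ W, g j y = 0 := fun j y hy => by
      simp [g, Metric.infDist_zero_of_mem (show y ∈ Wᶜ from hy)]
    have hg0 : ∀ j y, ‖y‖ < ε → g j y = 0 := fun j y hy =>
      hgW j y fun h => absurd (hWε y h) (not_le.2 hy)
    have hi0 : ∀ y, ‖y‖ < ε → W.indicator (fun _ => (1 : ℝ)) y = 0 := fun y hy =>
      Set.indicator_of_notMem (fun h => absurd (hWε y h) (not_le.2 hy)) _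
    have hgl : ∀ y, Tendsto (fun j => g j y) atTop (𝓝 (W.indicator (fun _ => (1 : ℝ)) y)) := by
      intro y
      by_cases hy : y ∈ W
      · rw [Set.indicator_of_mem hy]
        have hpos : 0 < Metric.infDist y Wᶜ :=
          (hW.isClosed_compl.notMem_iff_infDist_pos ⟨0, h0⟩).1 fun h => h hy
        refine tendsto_const_nhds.congr' ?_
        have := (tendsto_natCast_atTop_atTop (R := ℝ)).atTop_mul_const hpos
        filter_upwards [this.eventually_ge_atTop 1] with j hj
        simp [g, hj]
      · rw [Set.indicator_of_notMem hy]
        exact tendsto_const_nhds.congr fun j => (hgW j y hy).symm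
    have hsm : StronglyMeasurable (W.indicator fun _ => (1 : ℝ)) :=
      stronglyMeasurable_const.indicator hW.measurableSet
    have hfin : ∀ ω, jumpMeasure (fun s => X s ω) t W < ∞ := fun ω => by
      have h1 := (hc ω).integrable_jumpMeasure hsm hε hi0 t
      have h2 := h1.measure_norm_ge_lt_top one_pos
      refine (measure_mono fun y hy => ?_).trans_lt h2
      simp [Set.indicator_of_mem hy]
    refine ⟨?_, hfin⟩
    have hmeas : Measurable fun ω => jumpSum (W.indicator fun _ => (1 : ℝ)) (fun s => X s ω) 0 t :=
      measurable_of_tendsto_metrizable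
        (fun j => measurable_jumpSum hc (hgc j) hε (hg0 j) zero_le
          fun u v _ _ _ => (hXm v).sub (hXm u))
        (tendsto_pi_nhds.2 fun ω => (hc ω).tendsto_jumpSum hε hg0 hgl 0 t)
    convert ENNReal.measurable_ofReal.comp hmeas using 1
    ext ω
    rw [Function.comp_apply, ← (hc ω).integral_jumpMeasure hsm hε hi0 t,
      integral_indicator hW.measurableSet]
    simp [ENNReal.ofReal_toReal (hfin ω).ne, measureReal_def]
  let V : ℕ → Set (EuclideanSpace ℝ (Fin n)) := fun j => {y | 1 / ((j : ℝ) + 1) < ‖y‖}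
  have hV : ∀ j, IsOpen (V j) := fun j => isOpen_lt continuous_const continuous_norm
  have hres : ∀ j, Measurable fun ω => (jumpMeasure (fun s => X s ω) t).restrict (V j) := by
    intro j
    have hj : (0 : ℝ) < 1 / ((j : ℝ) + 1) := by positivity
    have h1 := hopen (V j) _ (hV j) hj fun y hy => (le_of_lt hy)
    have : ∀ ω, IsFiniteMeasure ((jumpMeasure (fun s => X s ω) t).restrict (V j)) := fun ω =>
      ⟨by simpa using h1.2 ω⟩
    refine Measurable.measure_of_isPiSystem (BorelSpace.measurable_eq (α := EuclideanSpace ℝ (Fin n))) isPiSystem_isOpen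
      (fun U hU => ?_) ?_
    · replace hU : IsOpen U := hU
      simp_rw [Measure.restrict_apply (IsOpen.measurableSet hU)]
      exact (hopen _ _ (IsOpen.inter hU (hV j)) hj fun y hy => (le_of_lt hy.2)).1
    · simpa using h1.1
  refine Measure.measurable_of_measurable_coe _ fun B hB => ?_
  have hVm : Monotone V := by
    intro i j hij y hy
    have h1 : 1 / ((i : ℝ) + 1) < ‖y‖ := hy
    have h2 : 1 / ((j : ℝ) + 1) ≤ 1 / ((i : ℝ) + 1) :=
      one_div_le_one_div_of_le (by positivity) (by gcongr)
    exact h2.trans_lt h1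
  have hB0 : ∀ ω, jumpMeasure (fun s => X s ω) t B =
      ⨆ j, (jumpMeasure (fun s => X s ω) t).restrict (V j) B := by
    intro ω
    have hU : B \ {0} = ⋃ j, B ∩ V j := by
      ext y
      simp only [Set.mem_sdiff, Set.mem_singleton_iff, Set.mem_iUnion, Set.mem_inter_iff, V,
        Set.mem_ofPred_eq, exists_and_left, and_congr_right_iff]
      refine fun _ => ⟨fun h => exists_nat_one_div_lt (norm_pos_iff.2 h), fun ⟨j, hj⟩ h => ?_⟩
      rw [h, norm_zero] at hj
      exact absurd hj (not_lt.2 (by positivity))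
    have hz : jumpMeasure (fun s => X s ω) t {0} = 0 := by
      rw [jumpMeasure, Measure.sum_apply _ (measurableSet_singleton _), ENNReal.tsum_eq_zero]
      intro s
      rw [Measure.dirac_apply' _ (measurableSet_singleton _)]
      simp [s.2.2.2]
    rw [← measure_sdiff_null hz, hU, Monotone.measure_iUnion]
    · simp_rw [Measure.restrict_apply hB]
    · exact fun i j hij => Set.inter_subset_inter_right _ (hVm hij)
  simp_rw [hB0]
  exact Measurable.iSup fun j => (Measure.measurable_coe hB).comp (hres j)

end Measurability

/-! ### Square integrability from bounded jumps -/

section Moments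

/-- Stop at the first index `k` where the norm exceeds `a`. Unless some step is larger than 2 or the
start is nonzero, the norm there is at most `a + 2`, so exceeding `a + b + 2` requires a later
increment above `b`, which is independent of the past at `k`. -/
lemma measure_exists_norm_gt_le {E Ω : Type*} [NormedAddCommGroup E] [MeasurableSpace E]
    [BorelSpace E] [SecondCountableTopology E] {mΩ : MeasurableSpace Ω}
    {P : Measure Ω} {Y : ℕ → Ω → E} {𝒢 ℋ : ℕ → MeasurableSpace Ω} (h𝒢 : Monotone 𝒢)
    (h𝒢m : ∀ k, 𝒢 k ≤ mΩ) (hY : ∀ k, Measurable[𝒢 k] (Y k)) (hind : ∀ k, Indep (ℋ k) (𝒢 k) P)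
    (hYℋ : ∀ k i, k ≤ i → Measurable[ℋ k] fun ω => Y i ω - Y k ω) (N : ℕ) {a b : ℝ} (ha : 0 ≤ a)
    (hb : 0 ≤ b) :
    P {ω | ∃ k ≤ N, a + b + 2 < ‖Y k ω‖} ≤
      P ({ω | Y 0 ω ≠ 0} ∪ {ω | ∃ k < N, 2 < ‖Y (k + 1) ω - Y k ω‖}) +
        P {ω | ∃ k ≤ N, b / 2 < ‖Y k ω‖} * P {ω | ∃ k ≤ N, a < ‖Y k ω‖} := by
  let A : ℕ → Set Ω := fun k => {ω | a < ‖Y k ω‖ ∧ ∀ i < k, ‖Y i ω‖ ≤ a}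
  let W : ℕ → Set Ω := fun k => {ω | ∃ i ≤ N, k ≤ i ∧ b < ‖Y i ω - Y k ω‖}
  have hgt : ∀ c : ℝ, MeasurableSet {y : E | c < ‖y‖} := fun c =>
    measurableSet_lt measurable_const measurable_norm
  have hle : ∀ c : ℝ, MeasurableSet {y : E | ‖y‖ ≤ c} := fun c =>
    measurableSet_le measurable_norm measurable_const
  have hA : ∀ k, MeasurableSet[𝒢 k] (A k) := by
    intro k
    refine MeasurableSet.inter (hY k (hgt a)) ?_
    have : {ω | ∀ i < k, ‖Y i ω‖ ≤ a} = ⋂ i, ⋂ (_ : i < k), {ω | ‖Y i ω‖ ≤ a} := by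
      ext; simp
    change MeasurableSet[𝒢 k] {ω | ∀ i < k, ‖Y i ω‖ ≤ a}
    rw [this]
    exact MeasurableSet.iInter fun i => MeasurableSet.iInter fun hi =>
      h𝒢 hi.le _ (hY i (hle a))
  have hW : ∀ k, MeasurableSet[ℋ k] (W k) := by
    intro k
    have : W k = ⋃ i, ⋃ (_ : i ≤ N), ⋃ (_ : k ≤ i), {ω | b < ‖Y i ω - Y k ω‖} := by
      ext; simp [W]; tauto
    rw [this]
    exact MeasurableSet.iUnion fun i => MeasurableSet.iUnion fun _ => MeasurableSet.iUnion fun hi =>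
      hYℋ k i hi (hgt b)
  have hsub : {ω | ∃ k ≤ N, a + b + 2 < ‖Y k ω‖} ⊆
      ({ω | Y 0 ω ≠ 0} ∪ {ω | ∃ k < N, 2 < ‖Y (k + 1) ω - Y k ω‖}) ∪
        ⋃ k ∈ Finset.range (N + 1), W k ∩ A k := by
    rintro ω ⟨i, hiN, hi⟩
    by_cases hR : ω ∈ ({ω | Y 0 ω ≠ 0} ∪ {ω | ∃ k < N, 2 < ‖Y (k + 1) ω - Y k ω‖})
    · exact Or.inl hR
    refine Or.inr ?_
    simp only [Set.mem_union, Set.mem_ofPred_eq, not_or, not_exists, not_and, not_lt, not_not] at hR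
    have hex : ∃ k, a < ‖Y k ω‖ := ⟨i, by linarith⟩
    classical
    let k := Nat.find hex
    have hk : a < ‖Y k ω‖ := Nat.find_spec hex
    have hkmin : ∀ j < k, ‖Y j ω‖ ≤ a := fun j hj => not_lt.1 (Nat.find_min hex hj)
    have hki : k ≤ i := Nat.find_min' hex (by linarith)
    have hk2 : ‖Y k ω‖ ≤ a + 2 := by
      rcases Nat.eq_zero_or_pos k with h0 | hpos
      · rw [h0, hR.1, norm_zero]; linarith
      · obtain ⟨j, hj⟩ := Nat.exists_eq_succ_of_ne_zero hpos.ne'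
        have h1 := hR.2 j (by omega)
        have h2 := hkmin j (by omega)
        rw [hj, Nat.succ_eq_add_one]
        have h3 := norm_add_le (Y (j + 1) ω - Y j ω) (Y j ω)
        rw [sub_add_cancel] at h3
        linarith
    refine Set.mem_iUnion₂.2 ⟨k, by simp; omega, ⟨i, hiN, hki, ?_⟩, hk, hkmin⟩
    have h3 := norm_add_le (Y i ω - Y k ω) (Y k ω)
    rw [sub_add_cancel] at h3
    linarith
  -- If `Y i` and `Y k` differ by more than `b`, one of them has norm above `b / 2`; this avoids any
  -- use of stationarity.
  have hWq : ∀ k ≤ N, P (W k) ≤ P {ω | ∃ k ≤ N, b / 2 < ‖Y k ω‖} := by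
    intro k hk
    refine measure_mono ?_
    rintro ω ⟨i, hi, -, hib⟩
    by_contra hcon
    simp only [Set.mem_ofPred_eq, not_exists, not_and, not_lt] at hcon
    linarith [norm_sub_le (Y i ω) (Y k ω), hcon i hi, hcon k hk]
  refine (measure_mono hsub).trans ((measure_union_le _ _).trans ?_)
  gcongr
  calc P (⋃ k ∈ Finset.range (N + 1), W k ∩ A k)
      ≤ ∑ k ∈ Finset.range (N + 1), P (W k ∩ A k) := measure_biUnion_finset_le _ _
    _ ≤ ∑ k ∈ Finset.range (N + 1), P {ω | ∃ k ≤ N, b / 2 < ‖Y k ω‖} * P (A k) := by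
        refine Finset.sum_le_sum fun k hk => ?_
        rw [(Indep_iff _ _ _).1 (hind k) _ _ (hW k) (hA k)]
        exact mul_le_mul_left (hWq k (by simpa [Nat.lt_succ_iff] using hk)) _
    _ = P {ω | ∃ k ≤ N, b / 2 < ‖Y k ω‖} * P (⋃ k ∈ Finset.range (N + 1), A k) := by
        rw [← Finset.mul_sum, measure_biUnion_finset _ fun k _ => h𝒢m k _ (hA k)]
        intro i _ j _ hij
        refine Set.disjoint_left.2 fun ω hi hj => ?_
        rcases lt_or_gt_of_ne hij with h | h
        · exact absurd (hj.2 i h) (not_le.2 hi.1)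
        · exact absurd (hi.2 j h) (not_le.2 hj.1)
    _ ≤ _ := by
        gcongr
        refine Set.iUnion₂_subset fun k hk ω hω => ⟨k, ?_, hω.1⟩
        simpa [Nat.lt_succ_iff] using hk

lemma memLp_two_of_tail {E Ω : Type*} [NormedAddCommGroup E] {mΩ : MeasurableSpace Ω}
    {P : Measure Ω} {Z : Ω → E} (hZ : AEStronglyMeasurable Z P) {c : ℝ} (hc : 0 < c)
    (h : ∀ k : ℕ, P {ω | k * c < ‖Z ω‖} ≤ 2⁻¹ ^ k) : MemLp Z 2 P := by
  refine ⟨hZ, ?_⟩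
  rw [eLpNorm_lt_top_iff_lintegral_rpow_enorm_lt_top (by norm_num) (by norm_num)]
  -- Only the term with `k * c < ‖Z ω‖ ≤ (k + 1) * c` is needed.
  have hpt : ∀ ω, ‖Z ω‖ₑ ^ (2 : ℝ≥0∞).toReal ≤ ∑' k : ℕ,
      {ω | k * c < ‖Z ω‖}.indicator (fun _ => ENNReal.ofReal (((k + 1) * c) ^ 2)) ω := by
    intro ω
    by_cases h0 : Z ω = 0
    · simp [h0]
    have hpos : 0 < ‖Z ω‖ / c := div_pos (norm_pos_iff.2 h0) hc
    obtain ⟨k, hk⟩ := Nat.exists_eq_succ_of_ne_zero (Nat.ceil_pos.2 hpos).ne'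
    have h1 : (k : ℝ) * c < ‖Z ω‖ := by
      rw [← lt_div_iff₀ hc]; exact Nat.lt_ceil.1 (by omega)
    have h2 : ‖Z ω‖ ≤ (k + 1) * c := by
      rw [← div_le_iff₀ hc]
      have := Nat.le_ceil (‖Z ω‖ / c)
      rw [hk] at this
      exact_mod_cast this
    refine le_trans ?_ (ENNReal.le_tsum k)
    rw [Set.indicator_of_mem (by exact h1)]
    rw [ENNReal.toReal_ofNat, ← ofReal_norm, ENNReal.ofReal_rpow_of_nonneg (norm_nonneg _) (by norm_num)]
    refine ENNReal.ofReal_le_ofReal ?_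
    rw [Real.rpow_two]
    gcongr
  calc ∫⁻ ω, ‖Z ω‖ₑ ^ (2 : ℝ≥0∞).toReal ∂P
      ≤ ∫⁻ ω, ∑' k : ℕ, {ω | k * c < ‖Z ω‖}.indicator
          (fun _ => ENNReal.ofReal (((k + 1) * c) ^ 2)) ω ∂P := lintegral_mono hpt
    _ = ∑' k : ℕ, ENNReal.ofReal (((k + 1) * c) ^ 2) * P {ω | k * c < ‖Z ω‖} := by
        have hm : ∀ k : ℕ, NullMeasurableSet {ω | k * c < ‖Z ω‖} P := fun k =>
          nullMeasurableSet_lt aemeasurable_const hZ.norm.aemeasurable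
        rw [lintegral_tsum fun k => aemeasurable_const.indicator₀ (hm k)]
        exact tsum_congr fun k => lintegral_indicator_const₀ (hm k) _
    _ ≤ ∑' k : ℕ, ENNReal.ofReal (((k + 1) * c) ^ 2 * 2⁻¹ ^ k) := by
        refine ENNReal.tsum_le_tsum fun k => ?_
        rw [ENNReal.ofReal_mul (by positivity)]
        gcongr
        refine (h k).trans (le_of_eq ?_)
        rw [ENNReal.ofReal_pow (by norm_num), ENNReal.ofReal_inv_of_pos (by norm_num)]
        norm_num
    _ < ∞ := by
        have hs : Summable fun k : ℕ => ((k + 1 : ℝ) * c) ^ 2 * 2⁻¹ ^ k := by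
          have h1 := summable_pow_mul_geometric_of_norm_lt_one 2 (r := (2⁻¹ : ℝ)) (by norm_num)
          have h2 := (summable_nat_add_iff 1).2 h1
          refine (h2.mul_left (2 * c ^ 2)).congr fun k => ?_
          push_cast
          rw [pow_succ]
          ring
        rw [← ENNReal.ofReal_tsum_of_nonneg (fun k => by positivity) hs]
        exact ENNReal.ofReal_lt_top

variable {n : ℕ} {Ω : Type*} {mΩ : MeasurableSpace Ω} {P : Measure Ω}
  {ℱ : Filtration ℝ≥0 mΩ} {X : ℝ≥0 → Ω → EuclideanSpace ℝ (Fin n)}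

/-- `X` exceeds the level `a` at some point of the grid of mesh `T / 2 ^ j` of `[0, T]`. -/
def gridExceeds (X : ℝ≥0 → Ω → EuclideanSpace ℝ (Fin n)) (T : ℝ≥0) (a : ℝ) (j : ℕ) : Set Ω :=
  {ω | ∃ k ≤ 2 ^ j, a < ‖X ((k : ℕ) * (T / (2 ^ j : ℕ))) ω‖}

lemma gridExceeds_mono (X : ℝ≥0 → Ω → EuclideanSpace ℝ (Fin n)) (T : ℝ≥0) (a : ℝ) :
    Monotone (gridExceeds X T a) := by
  refine monotone_nat_of_le_succ fun j ω => ?_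
  rintro ⟨k, hk, h⟩
  refine ⟨2 * k, by rw [pow_succ]; omega, ?_⟩
  have e : ((2 * k : ℕ) : ℝ≥0) * (T / (2 ^ (j + 1) : ℕ)) = (k : ℕ) * (T / (2 ^ j : ℕ)) := by
    push_cast
    rw [pow_succ]
    field_simp
  rwa [e]

/-- The function `max (‖y‖ - 1) 0` vanishes on every jump, so its grid sums tend to 0 almost surely,
whereas a single increment above 2 makes the sum at least 1. -/
lemma tendsto_measure_big_increment [IsProbabilityMeasure P] (hX : IsLevyProcess X ℱ P)
    (hcadlag : ∀ ω, IsCadlag fun t => X t ω)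
    (hjump : ∀ᵐ ω ∂P, ∀ t, ‖jump (fun s => X s ω) t‖ ≤ 1) (T : ℝ≥0) :
    Tendsto (fun m : ℕ => P ({ω | X 0 ω ≠ 0} ∪
      {ω | ∃ k < m, 2 < ‖X ((k + 1 : ℕ) * (T / m)) ω - X ((k : ℕ) * (T / m)) ω‖}))
      atTop (𝓝 0) := by
  let f : EuclideanSpace ℝ (Fin n) → ℝ := fun y => max (‖y‖ - 1) 0
  have hf : Continuous f := (continuous_norm.sub continuous_const).max continuous_const
  have hf0 : ∀ y, ‖y‖ ≤ 1 → f y = 0 := fun y hy => max_eq_right (by linarith)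
  have hfpos : ∀ y, 0 ≤ f y := fun y => le_max_right _ _
  have hlim : ∀ᵐ ω ∂P, Tendsto (fun m => gridSum f (fun t => X t ω) 0 T m) atTop (𝓝 0) := by
    filter_upwards [hjump] with ω hω
    have := (hcadlag ω).tendsto_gridSum hf one_pos (fun y hy => hf0 y hy.le) 0 T
    rwa [jumpSum_eq_zero fun r _ => hf0 _ (hω r)] at this
  have hmeas := tendstoInMeasure_of_tendsto_ae (fun m => (measurable_gridSum hf
    (fun u v _ _ _ => (hX.measurable v).sub (hX.measurable u)) m).aestronglyMeasurable) hlim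
  have h1 := hmeas 1 one_pos
  have hzero : P {ω | X 0 ω ≠ 0} = 0 := hX.zero
  refine tendsto_of_tendsto_of_tendsto_of_le_of_le tendsto_const_nhds h1 (fun _ => zero_le)
    fun m => ?_
  refine (measure_union_le _ _).trans ?_
  rw [hzero, zero_add]
  refine measure_mono ?_
  rintro ω ⟨k, hk, h⟩
  have h2 : 1 ≤ gridSum f (fun t => X t ω) 0 T m := by
    refine le_trans ?_ (Finset.single_le_sum (fun i _ => hfpos _) (Finset.mem_range.2 hk))
    simp only [zero_add]
    exact le_max_of_le_left (by linarith)
  change (1 : ℝ≥0∞) ≤ edist _ _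
  rw [edist_dist, dist_zero_right, Real.norm_of_nonneg (zero_le_one.trans h2)]
  simpa using h2

lemma IsLevyProcess.memLp_two [IsProbabilityMeasure P] (hX : IsLevyProcess X ℱ P)
    (hcadlag : ∀ ω, IsCadlag fun t => X t ω)
    (hjump : ∀ᵐ ω ∂P, ∀ t, ‖jump (fun s => X s ω) t‖ ≤ 1) (T : ℝ≥0) : MemLp (X T) 2 P := by
  let G : ℝ → ℝ≥0∞ := fun a => P (⋃ j, gridExceeds X T a j)
  have hGlim : ∀ a, Tendsto (fun j => P (gridExceeds X T a j)) atTop (𝓝 (G a)) := fun a =>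
    tendsto_measure_iUnion_atTop (gridExceeds_mono X T a)
  have hrec : ∀ a b, 0 ≤ a → 0 ≤ b → G (a + b + 2) ≤ G (b / 2) * G a := by
    intro a b ha hb
    have hR := (tendsto_measure_big_increment hX hcadlag hjump T).comp
      (tendsto_pow_atTop_atTop_of_one_lt one_lt_two)
    have hle : ∀ j : ℕ, P (gridExceeds X T (a + b + 2) j) ≤ P ({ω | X 0 ω ≠ 0} ∪
      {ω | ∃ k < 2 ^ j, 2 < ‖X ((k + 1 : ℕ) * (T / (2 ^ j : ℕ))) ω - X ((k : ℕ) * (T / (2 ^ j : ℕ))) ω‖}) +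
        G (b / 2) * G a := by
      intro j
      have hmono : Monotone fun k : ℕ => (k : ℝ≥0) * (T / (2 ^ j : ℕ)) := fun i k hik => by
        dsimp only; gcongr
      have h1 := measure_exists_norm_gt_le (P := P)
        (Y := fun k => X ((k : ℕ) * (T / (2 ^ j : ℕ))))
        (𝒢 := fun k => ℱ ((k : ℕ) * (T / (2 ^ j : ℕ))))
        (ℋ := fun k => futureIncrements X ((k : ℕ) * (T / (2 ^ j : ℕ))))
        (fun i k hik => ℱ.mono (hmono hik)) (fun k => ℱ.le _) (fun k => hX.adapted _)
        (fun k => hX.indep_futureIncrements _)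
        (fun k i hki => measurable_futureIncrements X le_rfl (hmono hki)) (2 ^ j) ha hb
      simp only [Nat.cast_zero, zero_mul] at h1
      refine h1.trans ?_
      gcongr
      · exact measure_mono (Set.subset_iUnion (gridExceeds X T (b / 2)) j)
      · exact measure_mono (Set.subset_iUnion (gridExceeds X T a) j)
    have := le_of_tendsto_of_tendsto' (hGlim (a + b + 2)) (hR.add_const (G (b / 2) * G a)) hle
    simpa using this
  have hGtop : Tendsto (fun m : ℕ => G m) atTop (𝓝 0) := by
    have h1 : ⋂ m : ℕ, ⋃ j, gridExceeds X T m j = ∅ := by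
      ext ω
      simp only [Set.mem_iInter, Set.mem_iUnion, Set.mem_empty_iff_false, iff_false, not_forall,
        not_exists]
      obtain ⟨C, hC⟩ := (hcadlag ω).exists_norm_le T
      obtain ⟨m, hm⟩ := exists_nat_gt C
      refine ⟨m, fun j ⟨k, hk, h⟩ => ?_⟩
      have hkT : (k : ℝ≥0) * (T / (2 ^ j : ℕ)) ≤ T := by
        calc (k : ℝ≥0) * (T / (2 ^ j : ℕ)) ≤ (2 ^ j : ℕ) * (T / (2 ^ j : ℕ)) := by gcongr
          _ = T := mul_div_cancel₀ _ (by simp)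
      linarith [hC _ hkT]
    have h2 := tendsto_measure_iInter_atTop (μ := P) (s := fun m : ℕ => ⋃ j, gridExceeds X T m j)
      (fun m => (MeasurableSet.iUnion fun j => by
        have : gridExceeds X T m j = ⋃ k, ⋃ (_ : k ≤ 2 ^ j),
            {ω | (m : ℝ) < ‖X ((k : ℕ) * (T / (2 ^ j : ℕ))) ω‖} := by ext; simp [gridExceeds]
        rw [this]
        exact MeasurableSet.iUnion fun k => MeasurableSet.iUnion fun _ =>
          measurableSet_lt measurable_const (hX.measurable _).norm).nullMeasurableSet)
      (fun i m him => Set.iUnion_mono fun j ω => by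
        rintro ⟨k, hk, h⟩
        exact ⟨k, hk, lt_of_le_of_lt (by exact_mod_cast him) h⟩) ⟨0, measure_ne_top _ _⟩
    rwa [h1, measure_empty] at h2
  obtain ⟨m, hm⟩ := (hGtop.eventually (Iio_mem_nhds (show (0 : ℝ≥0∞) < 2⁻¹ by norm_num))).exists
  have hc : (0 : ℝ) < 2 * m + 2 := by positivity
  -- Taking `b = 2 * m` makes `G (b / 2) = G m < 1 / 2`, so each step of length `2 * m + 2` halves
  -- the tail.
  have hG : ∀ k : ℕ, G (k * (2 * m + 2)) ≤ 2⁻¹ ^ k := by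
    intro k
    induction k with
    | zero => simpa using prob_le_one
    | succ k ih =>
      have h1 := hrec (k * (2 * m + 2)) (2 * m) (by positivity) (by positivity)
      rw [show ((k + 1 : ℕ) : ℝ) * (2 * m + 2) = k * (2 * m + 2) + 2 * m + 2 by push_cast; ring]
      refine h1.trans ?_
      rw [mul_div_cancel_left₀ _ (two_ne_zero' ℝ), pow_succ, mul_comm]
      exact mul_le_mul' ih (le_of_lt hm)
  refine memLp_two_of_tail (hX.measurable T).aestronglyMeasurable hc fun k => (le_trans ?_ (hG k))
  -- The coarsest grid already contains `T`, as its point of index 1.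
  refine measure_mono fun ω hω => Set.mem_iUnion.2 ⟨0, 1, by simp, ?_⟩
  simpa using hω

end Moments

/-! ### Limits under `L²` bounds, and additive functions -/

section SquareBounds

variable {Ω : Type*} {mΩ : MeasurableSpace Ω} {P : Measure Ω}

lemma memLp_two_of_tendsto_ae {Y : ℕ → Ω → ℝ} {Z : Ω → ℝ} {K : ℕ → ℝ} {L : ℝ}
    (hY : ∀ m, MemLp (Y m) 2 P) (hK : ∀ m, ∫ ω, Y m ω ^ 2 ∂P ≤ K m) (hL : Tendsto K atTop (𝓝 L))
    (hlim : ∀ᵐ ω ∂P, Tendsto (fun m => Y m ω) atTop (𝓝 (Z ω))) :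
    MemLp Z 2 P ∧ ∫ ω, Z ω ^ 2 ∂P ≤ L := by
  have hZ : AEStronglyMeasurable Z P := aestronglyMeasurable_of_tendsto_ae atTop (fun m => (hY m).1) hlim
  have hL0 : 0 ≤ L := ge_of_tendsto' hL fun m => (integral_nonneg fun ω => sq_nonneg _).trans (hK m)
  have h1 : ∫⁻ ω, ENNReal.ofReal (Z ω ^ 2) ∂P ≤ ENNReal.ofReal L := by
    calc ∫⁻ ω, ENNReal.ofReal (Z ω ^ 2) ∂P
        = ∫⁻ ω, liminf (fun m => ENNReal.ofReal (Y m ω ^ 2)) atTop ∂P := by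
          refine lintegral_congr_ae ?_
          filter_upwards [hlim] with ω hω
          exact ((ENNReal.continuous_ofReal.tendsto _).comp (hω.pow 2)).liminf_eq.symm
      _ ≤ liminf (fun m => ∫⁻ ω, ENNReal.ofReal (Y m ω ^ 2) ∂P) atTop :=
          lintegral_liminf_le' fun m => ((hY m).1.aemeasurable.pow_const 2).ennreal_ofReal
      _ ≤ liminf (fun m => ENNReal.ofReal (K m)) atTop := by
          refine liminf_le_liminf (Eventually.of_forall fun m => ?_)
          rw [← ofReal_integral_eq_lintegral_ofReal (hY m).integrable_sq
            (Eventually.of_forall fun ω => sq_nonneg _)]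
          exact ENNReal.ofReal_le_ofReal (hK m)
      _ = ENNReal.ofReal L := ((ENNReal.continuous_ofReal.tendsto _).comp hL).liminf_eq
  have hint : Integrable (fun ω => Z ω ^ 2) P := by
    refine ⟨hZ.pow 2, ?_⟩
    rw [hasFiniteIntegral_iff_ofReal (Eventually.of_forall fun ω => sq_nonneg _)]
    exact h1.trans_lt ENNReal.ofReal_lt_top
  refine ⟨(memLp_two_iff_integrable_sq hZ).2 hint, ?_⟩
  rw [← ofReal_integral_eq_lintegral_ofReal hint (Eventually.of_forall fun ω => sq_nonneg _)] at h1
  exact (ENNReal.ofReal_le_ofReal_iff hL0).1 h1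

/-- A bound in `L²` gives uniform integrability, and Vitali's theorem applies. -/
lemma tendsto_integral_of_sq_le [IsProbabilityMeasure P] {Y : ℕ → Ω → ℝ} {Z : Ω → ℝ} {K : ℝ}
    (hY : ∀ m, MemLp (Y m) 2 P) (hK : ∀ m, ∫ ω, Y m ω ^ 2 ∂P ≤ K)
    (hlim : ∀ᵐ ω ∂P, Tendsto (fun m => Y m ω) atTop (𝓝 (Z ω))) :
    Tendsto (fun m => ∫ ω, Y m ω ∂P) atTop (𝓝 (∫ ω, Z ω ∂P)) := by
  have hZ := (memLp_two_of_tendsto_ae hY hK tendsto_const_nhds hlim).1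
  have hK0 : 0 ≤ K := (integral_nonneg fun ω => sq_nonneg _).trans (hK 0)
  refine tendsto_integral_of_L1' Z hZ.1
    (Eventually.of_forall fun m => (hY m).integrable (by norm_num)) ?_
  refine tendsto_Lp_finite_of_tendsto_ae le_rfl (by norm_num) (fun m => (hY m).1)
    (hZ.mono_exponent (by norm_num)) ?_ hlim
  refine unifIntegrable_of le_rfl (by norm_num) (fun m => (hY m).1) fun ε hε => ?_
  -- Above this level `|Y| ≤ Y² ε / (K + 1)`; the `+ 1` keeps the quotient meaningful when `K = 0`.
  refine ⟨⟨(K + 1) / ε, by positivity⟩, fun m => ?_⟩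
  have hb : ∀ ω, ‖{x | (⟨(K + 1) / ε, by positivity⟩ : ℝ≥0) ≤ ‖Y m x‖₊}.indicator (Y m) ω‖ₑ ≤
      ENNReal.ofReal (Y m ω ^ 2 * (ε / (K + 1))) := by
    intro ω
    by_cases h : ω ∈ {x | (⟨(K + 1) / ε, by positivity⟩ : ℝ≥0) ≤ ‖Y m x‖₊}
    · rw [Set.indicator_of_mem h, ← ofReal_norm]
      refine ENNReal.ofReal_le_ofReal ?_
      have h' : (K + 1) / ε ≤ ‖Y m ω‖ := h
      have hsq : Y m ω ^ 2 = ‖Y m ω‖ ^ 2 := by rw [Real.norm_eq_abs, sq_abs]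
      rw [div_le_iff₀ hε] at h'
      rw [hsq, ← mul_div_assoc, le_div_iff₀ (by positivity)]
      nlinarith [norm_nonneg (Y m ω)]
    · rw [Set.indicator_of_notMem h]; simp
  rw [eLpNorm_one_eq_lintegral_enorm]
  refine (lintegral_mono hb).trans ?_
  rw [← ofReal_integral_eq_lintegral_ofReal ((hY m).integrable_sq.mul_const _)
    (Eventually.of_forall fun ω => by positivity), integral_mul_const]
  refine ENNReal.ofReal_le_ofReal ?_
  rw [← mul_div_assoc, div_le_iff₀ (by positivity)]
  nlinarith [hK m]

/-- Nonnegativity makes `φ` monotone, and enclosing `n * t` between consecutive integers gives an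
error of at most `φ 1 / n`. -/
lemma eq_mul_of_additive {φ : ℝ≥0 → ℝ} (h0 : ∀ t, 0 ≤ φ t) (hadd : ∀ s t, φ (s + t) = φ s + φ t)
    (t : ℝ≥0) : φ t = t * φ 1 := by
  have hmono : Monotone φ := fun s t hst => by
    obtain ⟨u, rfl⟩ := exists_add_of_le hst
    rw [hadd]; linarith [h0 u]
  have hz : φ 0 = 0 := by have := hadd 0 0; simp at this; exact this
  have hn : ∀ (n : ℕ) s, φ (n * s) = n * φ s := by
    intro n s
    induction n with
    | zero => simp [hz]
    | succ n ih => push_cast; rw [add_mul, one_mul, hadd, ih]; ring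
  have key : ∀ n : ℕ, n * |φ t - t * φ 1| ≤ φ 1 := by
    intro n
    have h1 := hmono (Nat.floor_le (show 0 ≤ (n : ℝ≥0) * t from zero_le))
    have h2 := hmono (Nat.lt_floor_add_one ((n : ℝ≥0) * t)).le
    rw [hn] at h2
    rw [hn, ← mul_one ((⌊(n : ℝ≥0) * t⌋₊ : ℕ) : ℝ≥0), hn] at h1
    rw [hadd, ← mul_one ((⌊(n : ℝ≥0) * t⌋₊ : ℕ) : ℝ≥0), hn] at h2
    have h3 : ((⌊(n : ℝ≥0) * t⌋₊ : ℕ) : ℝ) ≤ n * t := by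
      exact_mod_cast Nat.floor_le (show 0 ≤ (n : ℝ≥0) * t from zero_le)
    have h4 : (n : ℝ) * t ≤ (⌊(n : ℝ≥0) * t⌋₊ : ℕ) + 1 := by
      exact_mod_cast (Nat.lt_floor_add_one ((n : ℝ≥0) * t)).le
    have h5 := h0 1
    rw [← Nat.abs_cast n, ← abs_mul, abs_le]
    constructor <;> nlinarith
  by_contra hne
  have hpos : 0 < |φ t - t * φ 1| := abs_pos.2 (sub_ne_zero.2 hne)
  obtain ⟨n, hn⟩ := exists_nat_gt (φ 1 / |φ t - t * φ 1|)
  rw [div_lt_iff₀ hpos] at hn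
  linarith [key n]

end SquareBounds

/-! ### Linearity of the second moment in time -/

section SecondMoment

variable {n : ℕ} {Ω : Type*} {mΩ : MeasurableSpace Ω} {P : Measure Ω}
  {ℱ : Filtration ℝ≥0 mΩ} {X : ℝ≥0 → Ω → EuclideanSpace ℝ (Fin n)}

lemma IsLevyProcess.indepFun (hX : IsLevyProcess X ℱ P) {s t u v : ℝ≥0} (huv : u ≤ v) (hvs : v ≤ s)
    (hst : s ≤ t) : IndepFun (fun ω => X t ω - X s ω) (fun ω => X v ω - X u ω) P := by
  obtain ⟨r, rfl⟩ := exists_add_of_le hst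
  refine (IndepFun_iff_Indep _ _ _).2 (indep_of_indep_of_le_right (hX.indep r s) ?_)
  exact Measurable.comap_le (m₁ := ℱ s) (((hX.adapted _).mono (ℱ.mono hvs) le_rfl).sub
    ((hX.adapted _).mono (ℱ.mono (huv.trans hvs)) le_rfl))

lemma IsLevyProcess.integral_sq_add [IsProbabilityMeasure P] (hX : IsLevyProcess X ℱ P) (h2 : ∀ t, MemLp (X t) 2 P)
    (h0 : ∀ t, ∫ ω, X t ω ∂P = 0) (s t : ℝ≥0) :
    ∫ ω, ‖X (s + t) ω‖ ^ 2 ∂P = ∫ ω, ‖X s ω‖ ^ 2 ∂P + ∫ ω, ‖X t ω‖ ^ 2 ∂P := by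
  have hc2 : ∀ t i, MemLp (fun ω => X t ω i) 2 P := fun t i => memLp_piLp_iff.1 (h2 t) i
  have hc0 : ∀ t i, ∫ ω, X t ω i ∂P = 0 := fun t i => by
    rw [← eval_integral_piLp fun i => (hc2 t i).integrable (by norm_num), h0]; rfl
  have hV : ∀ t, ∫ ω, ‖X t ω‖ ^ 2 ∂P = ∑ i, Var[fun ω => X t ω i; P] := fun t => by
    simp_rw [EuclideanSpace.real_norm_sq_eq]
    rw [integral_finsetSum _ fun i _ => (hc2 t i).integrable_sq]
    exact Finset.sum_congr rfl fun i _ =>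
      (variance_of_integral_eq_zero (hc2 t i).1.aemeasurable (hc0 t i)).symm
  have hproj : ∀ i, Measurable fun y : EuclideanSpace ℝ (Fin n) => y i := fun i => by fun_prop
  rw [hV, hV, hV, ← Finset.sum_add_distrib]
  refine Finset.sum_congr rfl fun i _ => ?_
  have hid : IdentDistrib (fun ω => (X (s + t) ω - X s ω) i) (fun ω => X t ω i) P P :=
    (hX.stationary t s).comp (hproj i)
  have hind : IndepFun (fun ω => X s ω i) (fun ω => (X (s + t) ω - X s ω) i) P := by
    have : IndepFun (fun ω => X s ω) (fun ω => X (s + t) ω - X s ω) P :=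
      (IndepFun_iff_Indep _ _ _).2 (indep_of_indep_of_le_left (hX.indep t s).symm
        (hX.adapted s).comap_le)
    exact this.comp (hproj i) (hproj i)
  rw [← hid.variance_eq, ← hind.variance_add (hc2 s i) (hid.memLp_iff.2 (hc2 t i))]
  congr 1
  ext ω
  simp

lemma IsLevyProcess.integral_sq_div [IsProbabilityMeasure P] (hX : IsLevyProcess X ℱ P) (h2 : ∀ t, MemLp (X t) 2 P)
    (h0 : ∀ t, ∫ ω, X t ω ∂P = 0) (h : ℝ≥0) {m : ℕ} (hm : m ≠ 0) :
    m * ∫ ω, ‖X (h / m) ω‖ ^ 2 ∂P = ∫ ω, ‖X h ω‖ ^ 2 ∂P := by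
  have key := eq_mul_of_additive (φ := fun t => ∫ ω, ‖X t ω‖ ^ 2 ∂P)
    (fun t => integral_nonneg fun ω => by positivity) (hX.integral_sq_add h2 h0)
  rw [key, key h]
  push_cast
  field_simp

end SecondMoment

/-- A càdlàg Lévy process which is square integrable and centred. -/
structure IsCentredLevyProcess {n : ℕ} {Ω : Type*} {mΩ : MeasurableSpace Ω}
    (X : ℝ≥0 → Ω → EuclideanSpace ℝ (Fin n)) (ℱ : Filtration ℝ≥0 mΩ) (P : Measure Ω) : Prop
    extends IsLevyProcess X ℱ P where
  cadlag : ∀ ω, IsCadlag fun t => X t ω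
  memLp : ∀ t, MemLp (X t) 2 P
  centred : ∀ t, ∫ ω, X t ω ∂P = 0

/-- A bounded continuous function which vanishes in the ball of radius `ε` around `0`. -/
structure IsTest {E F : Type*} [NormedAddCommGroup E] [NormedAddCommGroup F] (f : E → F)
    (ε C : ℝ) : Prop where
  continuous : Continuous f
  pos : 0 < ε
  norm_le : ∀ y, ‖f y‖ ≤ C
  eq_zero : ∀ y, ‖y‖ < ε → f y = 0

/-! ### Test functions vanishing near the origin -/

section Test

variable {E : Type*} [NormedAddCommGroup E] {f : E → ℝ} {ε C : ℝ}

lemma IsTest.nonneg (hf : IsTest f ε C) : 0 ≤ C := (norm_nonneg _).trans (hf.norm_le 0)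

lemma IsTest.sq (hf : IsTest f ε C) : IsTest (fun y => f y ^ 2) ε (C ^ 2) where
  continuous := hf.continuous.pow 2
  pos := hf.pos
  norm_le y := by
    rw [norm_pow]
    exact pow_le_pow_left₀ (norm_nonneg _) (hf.norm_le y) 2
  eq_zero y hy := by simp [hf.eq_zero y hy]

lemma IsTest.posPart (hf : IsTest f ε C) : IsTest (fun y => max (f y) 0) ε C where
  continuous := hf.continuous.max continuous_const
  pos := hf.pos
  norm_le y := by
    rw [Real.norm_of_nonneg (le_max_right _ _)]
    exact max_le ((le_abs_self _).trans (hf.norm_le y)) hf.nonneg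
  eq_zero y hy := by simp [hf.eq_zero y hy]

lemma IsTest.neg (hf : IsTest f ε C) : IsTest (fun y => -f y) ε C where
  continuous := hf.continuous.neg
  pos := hf.pos
  norm_le y := by rw [norm_neg]; exact hf.norm_le y
  eq_zero y hy := by simp [hf.eq_zero y hy]

/-- Quadratic domination is what makes `E f(X_{h/m})` of order `1 / m`, by comparison with the
second moment. -/
lemma IsTest.norm_le_sq (hf : IsTest f ε C) (y : E) : ‖f y‖ ≤ C / ε ^ 2 * ‖y‖ ^ 2 := by
  have := hf.pos
  have hC := hf.nonneg
  rcases lt_or_ge ‖y‖ ε with h | h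
  · rw [hf.eq_zero y h, norm_zero]; positivity
  · refine (hf.norm_le y).trans ?_
    rw [div_mul_eq_mul_div, le_div_iff₀ (by positivity)]
    gcongr

end Test

/-! ### Mean and variance of jump sums; second moment of the Lévy measure -/

section JumpSumMoments

variable {n : ℕ} {Ω : Type*} {mΩ : MeasurableSpace Ω} {P : Measure Ω}
  {ℱ : Filtration ℝ≥0 mΩ} {X : ℝ≥0 → Ω → EuclideanSpace ℝ (Fin n)}
  {f : EuclideanSpace ℝ (Fin n) → ℝ} {ε C : ℝ}

lemma IsTest.memLp_comp [IsProbabilityMeasure P] {G : Ω → EuclideanSpace ℝ (Fin n)}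
    (hf : IsTest f ε C) (hG : Measurable G)
    (p : ℝ≥0∞) : MemLp (fun ω => f (G ω)) p P :=
  MemLp.of_bound (hf.continuous.measurable.comp hG).aestronglyMeasurable C
    (Eventually.of_forall fun _ => hf.norm_le _)

lemma IsCentredLevyProcess.mul_abs_integral_le [IsProbabilityMeasure P] (hX : IsCentredLevyProcess X ℱ P)
    (hf : IsTest f ε C) (h : ℝ≥0) (m : ℕ) :
    m * |∫ ω, f (X (h / m) ω) ∂P| ≤ C / ε ^ 2 * ∫ ω, ‖X h ω‖ ^ 2 ∂P := by
  have := hf.pos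
  have hC := hf.nonneg
  have hV : 0 ≤ ∫ ω, ‖X h ω‖ ^ 2 ∂P := integral_nonneg fun ω => by positivity
  rcases eq_or_ne m 0 with rfl | hm
  · simp only [Nat.cast_zero, zero_mul]; positivity
  · rw [← hX.integral_sq_div hX.memLp hX.centred h hm, mul_left_comm, ← integral_const_mul]
    gcongr
    refine (norm_integral_le_integral_norm (fun ω => f (X (h / m) ω))).trans ?_
    refine integral_mono_of_nonneg (Eventually.of_forall fun _ => norm_nonneg _)
      (((memLp_two_iff_integrable_sq_norm (hX.memLp _).1).1 (hX.memLp _)).const_mul _)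
      (Eventually.of_forall fun ω => hf.norm_le_sq _)

lemma IsCentredLevyProcess.identDistrib_increment (hX : IsCentredLevyProcess X ℱ P) (a h : ℝ≥0)
    (m k : ℕ) (hf : Measurable f) :
    IdentDistrib (fun ω => f (X (a + (k + 1 : ℕ) * (h / m)) ω - X (a + (k : ℕ) * (h / m)) ω))
      (fun ω => f (X (h / m) ω)) P P := by
  have := (hX.stationary (h / m) (a + (k : ℕ) * (h / m))).comp hf
  have e : a + (k + 1 : ℕ) * (h / m) = a + (k : ℕ) * (h / m) + h / m := by push_cast; ring
  rw [e]
  exact this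

lemma IsCentredLevyProcess.integral_gridSum [IsProbabilityMeasure P] (hX : IsCentredLevyProcess X ℱ P)
    (hf : IsTest f ε C)
    (a h : ℝ≥0) (m : ℕ) :
    ∫ ω, gridSum f (fun t => X t ω) a h m ∂P = m * ∫ ω, f (X (h / m) ω) ∂P := by
  simp only [gridSum]
  have hi : ∀ k ∈ Finset.range m, Integrable (fun ω =>
      f (X (a + (k + 1 : ℕ) * (h / m)) ω - X (a + (k : ℕ) * (h / m)) ω)) P := fun k _ =>
    (hf.memLp_comp ((hX.measurable _).sub (hX.measurable _)) 1).integrable le_rfl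
  rw [integral_finsetSum _ hi]
  rw [Finset.sum_congr rfl fun k _ =>
    (hX.identDistrib_increment a h m k hf.continuous.measurable).integral_eq]
  simp

lemma IsCentredLevyProcess.memLp_gridSum [IsProbabilityMeasure P] (hX : IsCentredLevyProcess X ℱ P)
    (hf : IsTest f ε C)
    (a h : ℝ≥0) (m : ℕ) : MemLp (fun ω => gridSum f (fun t => X t ω) a h m) 2 P :=
  memLp_finsetSum _ fun _ _ => hf.memLp_comp ((hX.measurable _).sub (hX.measurable _)) 2

lemma IsCentredLevyProcess.variance_gridSum_le [IsProbabilityMeasure P] (hX : IsCentredLevyProcess X ℱ P)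
    (hf : IsTest f ε C) (a h : ℝ≥0) (m : ℕ) :
    Var[fun ω => gridSum f (fun t => X t ω) a h m; P] ≤ m * ∫ ω, f (X (h / m) ω) ^ 2 ∂P := by
  have hmono : Monotone fun k : ℕ => a + (k : ℝ≥0) * (h / m) := fun i k hik => by
    dsimp only; gcongr
  have hL : ∀ k ∈ Finset.range m, MemLp (fun ω =>
      f (X (a + (k + 1 : ℕ) * (h / m)) ω - X (a + (k : ℕ) * (h / m)) ω)) 2 P := fun k _ =>
    hf.memLp_comp ((hX.measurable _).sub (hX.measurable _)) 2
  have hlt : ∀ i j : ℕ, i < j → IndepFun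
      (fun ω => f (X (a + (j + 1 : ℕ) * (h / m)) ω - X (a + (j : ℕ) * (h / m)) ω))
      (fun ω => f (X (a + (i + 1 : ℕ) * (h / m)) ω - X (a + (i : ℕ) * (h / m)) ω)) P :=
    fun i j hij => (hX.indepFun (hmono i.le_succ) (hmono hij) (hmono j.le_succ)).comp
      hf.continuous.measurable hf.continuous.measurable
  have hsum := IndepFun.variance_sum hL (fun i _ j _ hij => by
    rcases lt_or_gt_of_ne hij with h' | h'
    · exact (hlt i j h').symm
    · exact hlt j i h')
  have e : (fun ω => gridSum f (fun t => X t ω) a h m) = ∑ k ∈ Finset.range m, fun ω =>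
      f (X (a + (k + 1 : ℕ) * (h / m)) ω - X (a + (k : ℕ) * (h / m)) ω) := by
    ext ω; simp [gridSum]
  rw [e, hsum, Finset.sum_congr rfl fun k _ =>
    (hX.identDistrib_increment a h m k hf.continuous.measurable).variance_eq]
  rw [Finset.sum_const, Finset.card_range, nsmul_eq_mul]
  gcongr
  exact variance_le_expectation_sq (hf.memLp_comp (hX.measurable _) 2).1

/-- Variance plus squared mean, each controlled by `E|X_h|²` through quadratic domination of `f ^ 2`
and of `f`. -/
lemma IsCentredLevyProcess.exists_gridSum_bound [IsProbabilityMeasure P] (hX : IsCentredLevyProcess X ℱ P)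
    (hf : IsTest f ε C) (a h : ℝ≥0) :
    ∃ K, ∀ m, ∫ ω, gridSum f (fun t => X t ω) a h m ^ 2 ∂P ≤ K := by
  refine ⟨C ^ 2 / ε ^ 2 * ∫ ω, ‖X h ω‖ ^ 2 ∂P + (C / ε ^ 2 * ∫ ω, ‖X h ω‖ ^ 2 ∂P) ^ 2, fun m => ?_⟩
  have h1 := hX.variance_gridSum_le hf a h m
  have h2 := hX.mul_abs_integral_le hf h m
  have h3 := hX.mul_abs_integral_le hf.sq h m
  have h4 := variance_eq_sub (hX.memLp_gridSum hf a h m)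
  rw [hX.integral_gridSum hf] at h4
  have h5 : (m * ∫ ω, f (X (h / m) ω) ∂P) ^ 2 ≤ (C / ε ^ 2 * ∫ ω, ‖X h ω‖ ^ 2 ∂P) ^ 2 := by
    rw [← sq_abs, abs_mul, Nat.abs_cast]
    gcongr
  have h6 : m * ∫ ω, f (X (h / m) ω) ^ 2 ∂P ≤ m * |∫ ω, f (X (h / m) ω) ^ 2 ∂P| := by
    gcongr; exact le_abs_self _
  simp only [Pi.pow_apply] at h4
  linarith

lemma IsCentredLevyProcess.tendsto_gridSum (hX : IsCentredLevyProcess X ℱ P) (hf : IsTest f ε C)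
    (a h : ℝ≥0) : ∀ᵐ ω ∂P, Tendsto (fun m => gridSum f (fun t => X t ω) a h m) atTop
      (𝓝 (jumpSum f (fun t => X t ω) a (a + h))) :=
  Eventually.of_forall fun ω => (hX.cadlag ω).tendsto_gridSum hf.continuous hf.pos hf.eq_zero a h

lemma IsCentredLevyProcess.tendsto_mul_integral [IsProbabilityMeasure P] (hX : IsCentredLevyProcess X ℱ P)
    (hf : IsTest f ε C) (a h : ℝ≥0) :
    Tendsto (fun m : ℕ => m * ∫ ω, f (X (h / m) ω) ∂P) atTop
      (𝓝 (∫ ω, jumpSum f (fun t => X t ω) a (a + h) ∂P)) := by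
  obtain ⟨K, hK⟩ := hX.exists_gridSum_bound hf a h
  simp_rw [← hX.integral_gridSum hf a h]
  exact tendsto_integral_of_sq_le (hX.memLp_gridSum hf a h) hK (hX.tendsto_gridSum hf a h)

lemma IsCentredLevyProcess.memLp_jumpSum [IsProbabilityMeasure P] (hX : IsCentredLevyProcess X ℱ P)
    (hf : IsTest f ε C)
    (a h : ℝ≥0) : MemLp (fun ω => jumpSum f (fun t => X t ω) a (a + h)) 2 P := by
  obtain ⟨K, hK⟩ := hX.exists_gridSum_bound hf a h
  exact (memLp_two_of_tendsto_ae (hX.memLp_gridSum hf a h) hK tendsto_const_nhds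
    (hX.tendsto_gridSum hf a h)).1

lemma IsCentredLevyProcess.integrable_jumpSum [IsProbabilityMeasure P] (hX : IsCentredLevyProcess X ℱ P)
    (hf : IsTest f ε C)
    (a h : ℝ≥0) : Integrable (fun ω => jumpSum f (fun t => X t ω) a (a + h)) P :=
  (hX.memLp_jumpSum hf a h).integrable (by norm_num)

/-- The mean over `(a, a + h]` is the limit of `m E f(X_{h/m})`, which does not involve `a`. The
mean over `(0, t]` is thus additive and nonnegative, hence linear, and at `t = 1` it is the integral
against `levyMeasure` by definition. -/
lemma IsCentredLevyProcess.integral_jumpSum_of_nonneg [IsProbabilityMeasure P] (hX : IsCentredLevyProcess X ℱ P)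
    (hf : IsTest f ε C) (hf0 : ∀ y, 0 ≤ f y) (t : ℝ≥0) :
    Integrable f (levyMeasure X P) ∧
      ∫ ω, jumpSum f (fun s => X s ω) 0 t ∂P = t * ∫ y, f y ∂(levyMeasure X P) := by
  have hadd := eq_mul_of_additive (φ := fun t => ∫ ω, jumpSum f (fun s => X s ω) 0 t ∂P)
    (fun t => integral_nonneg fun ω => jumpSum_nonneg hf0 _ _ _) (fun s t => by
      have h1 : ∫ ω, jumpSum f (fun s => X s ω) 0 t ∂P =
          ∫ ω, jumpSum f (fun s => X s ω) s (s + t) ∂P := by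
        have := tendsto_nhds_unique (hX.tendsto_mul_integral hf 0 t) (hX.tendsto_mul_integral hf s t)
        simpa using this
      have i0 := hX.integrable_jumpSum hf 0 s
      rw [zero_add] at i0
      rw [h1, ← integral_add i0 (hX.integrable_jumpSum hf s t)]
      exact integral_congr_ae (Eventually.of_forall fun ω =>
        ((hX.cadlag ω).jumpSum_add hf.pos hf.eq_zero zero_le le_self_add).symm))
  have i1 := hX.integrable_jumpSum hf 0 1
  rw [zero_add] at i1
  have hlint : ∫⁻ y, ENNReal.ofReal (f y) ∂(levyMeasure X P) =
      ENNReal.ofReal (∫ ω, jumpSum f (fun s => X s ω) 0 1 ∂P) := by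
    rw [levyMeasure, Measure.lintegral_bind
      (measurable_jumpMeasure hX.measurable hX.cadlag 1).aemeasurable
      hf.continuous.measurable.ennreal_ofReal.aemeasurable,
      ofReal_integral_eq_lintegral_ofReal i1
        (Eventually.of_forall fun ω => jumpSum_nonneg hf0 _ _ _)]
    refine lintegral_congr fun ω => ?_
    rw [← ofReal_integral_eq_lintegral_ofReal ((hX.cadlag ω).integrable_jumpMeasure
      hf.continuous.stronglyMeasurable hf.pos hf.eq_zero 1) (Eventually.of_forall hf0),
      (hX.cadlag ω).integral_jumpMeasure hf.continuous.stronglyMeasurable hf.pos hf.eq_zero 1]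
  have hfi : Integrable f (levyMeasure X P) := by
    refine ⟨hf.continuous.aestronglyMeasurable, ?_⟩
    rw [hasFiniteIntegral_iff_ofReal (Eventually.of_forall hf0), hlint]
    exact ENNReal.ofReal_lt_top
  refine ⟨hfi, ?_⟩
  rw [hadd t, integral_eq_lintegral_of_nonneg_ae (Eventually.of_forall hf0)
    hf.continuous.aestronglyMeasurable, hlint, ENNReal.toReal_ofReal
    (integral_nonneg fun ω => jumpSum_nonneg hf0 _ _ _)]

lemma IsCentredLevyProcess.integral_jumpSum [IsProbabilityMeasure P] (hX : IsCentredLevyProcess X ℱ P)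
    (hf : IsTest f ε C) (t : ℝ≥0) :
    Integrable f (levyMeasure X P) ∧
      ∫ ω, jumpSum f (fun s => X s ω) 0 t ∂P = t * ∫ y, f y ∂(levyMeasure X P) := by
  have h1 := hX.integral_jumpSum_of_nonneg hf.posPart (fun y => le_max_right _ _) t
  have h2 := hX.integral_jumpSum_of_nonneg hf.neg.posPart (fun y => le_max_right _ _) t
  have i1 := hX.integrable_jumpSum hf.posPart 0 t
  have i2 := hX.integrable_jumpSum hf.neg.posPart 0 t
  rw [zero_add] at i1 i2
  have e : f = fun y => max (f y) 0 - max (-f y) 0 := by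
    ext y
    rcases le_total 0 (f y) with h | h
    · rw [max_eq_left h, max_eq_right (by linarith)]; ring
    · rw [max_eq_right h, max_eq_left (by linarith)]; ring
  constructor
  · rw [e]; exact h1.1.sub h2.1
  · rw [e, integral_sub h1.1 h2.1, mul_sub, ← h1.2, ← h2.2, ← integral_sub i1 i2]
    exact integral_congr_ae (Eventually.of_forall fun ω => (hX.cadlag ω).jumpSum_sub hf.pos
      hf.posPart.eq_zero hf.neg.posPart.eq_zero 0 t)

/-- Fatou's lemma for the centred grid sums, whose variance bounds `m E f(X_{t/m})²` converge by the
mean formula for `f ^ 2`. The inequality suffices; no isometry is needed. -/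
lemma IsCentredLevyProcess.variance_jumpSum_le [IsProbabilityMeasure P] (hX : IsCentredLevyProcess X ℱ P)
    (hf : IsTest f ε C) (t : ℝ≥0) :
    MemLp (fun ω => jumpSum f (fun s => X s ω) 0 t) 2 P ∧
    ∫ ω, (jumpSum f (fun s => X s ω) 0 t - t * ∫ y, f y ∂(levyMeasure X P)) ^ 2 ∂P ≤
      t * ∫ y, f y ^ 2 ∂(levyMeasure X P) := by
  have hm := hX.memLp_jumpSum hf 0 t
  have hlim := hX.tendsto_mul_integral hf 0 t
  have hlim2 := hX.tendsto_mul_integral hf.sq 0 t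
  rw [zero_add] at hm hlim hlim2
  refine ⟨hm, ?_⟩
  rw [(hX.integral_jumpSum hf t).2] at hlim
  rw [(hX.integral_jumpSum hf.sq t).2] at hlim2
  refine (memLp_two_of_tendsto_ae
    (Y := fun m ω => gridSum f (fun s => X s ω) 0 t m - m * ∫ ω, f (X (t / m) ω) ∂P)
    (fun m => (hX.memLp_gridSum hf 0 t m).sub (memLp_const _)) (fun m => ?_) hlim2 ?_).2
  · rw [← hX.integral_gridSum hf 0 t m, ← variance_eq_integral
      (hX.memLp_gridSum hf 0 t m).1.aemeasurable]
    exact hX.variance_gridSum_le hf 0 t m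
  · filter_upwards [hX.tendsto_gridSum hf 0 t] with ω hω
    rw [zero_add] at hω
    exact hω.sub hlim

/-- For a test function `g ≤ |y|²`, `∫ g dν` is the limit of `m E g(X_{1/m}) ≤ m E|X_{1/m}|² =
E|X_1|²`. Test functions converging to `min(|y|², 1)` and Fatou's lemma conclude. -/
lemma IsCentredLevyProcess.lintegral_sq_lt_top [IsProbabilityMeasure P] (hX : IsCentredLevyProcess X ℱ P) :
    ∫⁻ y in {y | ‖y‖ ≤ 1}, ‖y‖ₑ ^ 2 ∂(levyMeasure X P) < ∞ := by
  let g : ℕ → EuclideanSpace ℝ (Fin n) → ℝ := fun j y =>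
    min (‖y‖ ^ 2) 1 * min 1 (max (j * ‖y‖ - 1) 0)
  have hg0 : ∀ j y, 0 ≤ g j y := fun j y => by positivity
  have hg : ∀ j, IsTest (g j) (1 / (j + 1)) 1 := fun j =>
    { continuous := by fun_prop
      pos := by positivity
      norm_le := fun y => by
        rw [Real.norm_of_nonneg (hg0 j y)]
        exact mul_le_one₀ (min_le_right _ _) (by positivity) (min_le_left _ _)
      eq_zero := fun y hy => by
        rw [lt_div_iff₀ (by positivity)] at hy
        have : (j : ℝ) * ‖y‖ - 1 ≤ 0 := by nlinarith [norm_nonneg y]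
        simp [g, max_eq_right this] }
  have hgle : ∀ j y, g j y ≤ ‖y‖ ^ 2 := fun j y =>
    (mul_le_of_le_one_right (by positivity) (min_le_left _ _)).trans (min_le_left _ _)
  have hlim : ∀ y, Tendsto (fun j => g j y) atTop (𝓝 (min (‖y‖ ^ 2) 1)) := by
    intro y
    by_cases hy : y = 0
    · simp [g, hy]
    · have hpos := norm_pos_iff.2 hy
      refine tendsto_const_nhds.congr' ?_
      have := (tendsto_natCast_atTop_atTop (R := ℝ)).atTop_mul_const hpos
      filter_upwards [this.eventually_ge_atTop 2] with j hj
      have : (1 : ℝ) ≤ max (j * ‖y‖ - 1) 0 := le_max_of_le_left (by linarith)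
      simp [g, min_eq_left this]
  set V := ∫ ω, ‖X 1 ω‖ ^ 2 ∂P
  have hbound : ∀ j, ∫⁻ y, ENNReal.ofReal (g j y) ∂(levyMeasure X P) ≤ ENNReal.ofReal V := by
    intro j
    have h1 := hX.integral_jumpSum (hg j) 1
    rw [← ofReal_integral_eq_lintegral_ofReal h1.1 (Eventually.of_forall (hg0 j))]
    refine ENNReal.ofReal_le_ofReal ?_
    have h2 := hX.tendsto_mul_integral (hg j) 0 1
    rw [zero_add, h1.2] at h2
    simp only [NNReal.coe_one, one_mul] at h2
    refine le_of_tendsto h2 ?_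
    filter_upwards [eventually_ne_atTop 0] with m hm
    rw [show V = _ from (hX.integral_sq_div hX.memLp hX.centred 1 hm).symm]
    gcongr
    · exact ((hg j).memLp_comp (hX.measurable _) 1).integrable le_rfl
    · exact (memLp_two_iff_integrable_sq_norm (hX.memLp _).1).1 (hX.memLp _)
    · exact fun ω => hgle j _
  calc ∫⁻ y in {y | ‖y‖ ≤ 1}, ‖y‖ₑ ^ 2 ∂(levyMeasure X P)
      ≤ ∫⁻ y in {y | ‖y‖ ≤ 1}, ENNReal.ofReal (min (‖y‖ ^ 2) 1) ∂(levyMeasure X P) := by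
        refine setLIntegral_mono (by fun_prop) fun y hy => ?_
        have hy' : ‖y‖ ^ 2 ≤ 1 := pow_le_one₀ (norm_nonneg _) hy
        rw [min_eq_left hy', ENNReal.ofReal_pow (norm_nonneg _), ofReal_norm]
    _ ≤ ∫⁻ y, ENNReal.ofReal (min (‖y‖ ^ 2) 1) ∂(levyMeasure X P) := setLIntegral_le_lintegral _ _
    _ = ∫⁻ y, liminf (fun j => ENNReal.ofReal (g j y)) atTop ∂(levyMeasure X P) :=
        lintegral_congr fun y =>
          ((ENNReal.continuous_ofReal.tendsto _).comp (hlim y)).liminf_eq.symm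
    _ ≤ liminf (fun j => ∫⁻ y, ENNReal.ofReal (g j y) ∂(levyMeasure X P)) atTop :=
        lintegral_liminf_le fun j => (hg j).continuous.measurable.ennreal_ofReal
    _ ≤ liminf (fun _ => ENNReal.ofReal V) atTop :=
        liminf_le_liminf (Eventually.of_forall hbound)
    _ = ENNReal.ofReal V := liminf_const _
    _ < ∞ := ENNReal.ofReal_lt_top

end JumpSumMoments

/-! ### Compensated jump sums over shells -/

section Truncation

variable {n : ℕ} {Ω : Type*} {mΩ : MeasurableSpace Ω} {P : Measure Ω}
  {ℱ : Filtration ℝ≥0 mΩ} {X : ℝ≥0 → Ω → EuclideanSpace ℝ (Fin n)}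

/-- Supplies the dominating function for limits of test functions that vanish on a common ball. -/
lemma IsCentredLevyProcess.integrable_cutoff [IsProbabilityMeasure P]
    (hX : IsCentredLevyProcess X ℱ P) {ε : ℝ} (hε : 0 < ε) :
    ∃ φ : EuclideanSpace ℝ (Fin n) → ℝ, Integrable φ (levyMeasure X P) ∧ (∀ y, 0 ≤ φ y) ∧
      ∀ y, ε ≤ ‖y‖ → φ y = 1 := by
  refine ⟨fun y => min 1 (max (2 / ε * ‖y‖ - 1) 0), ?_, fun y => by positivity, fun y hy => ?_⟩
  · refine (hX.integral_jumpSum (ε := ε / 2) (C := 1) ?_ 1).1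
    exact
      { continuous := by fun_prop
        pos := half_pos hε
        norm_le := fun y => by
          rw [Real.norm_of_nonneg (by positivity)]
          exact min_le_left _ _
        eq_zero := fun y hy => by
          have : 2 / ε * ‖y‖ - 1 ≤ 0 := by
            rw [div_mul_eq_mul_div, sub_nonpos, div_le_one hε]; linarith
          rw [max_eq_right this, min_eq_right zero_le_one] }
  · have : 1 ≤ 2 / ε * ‖y‖ - 1 := by
      have : 2 ≤ 2 / ε * ‖y‖ := by rw [div_mul_eq_mul_div, le_div_iff₀ hε]; linarith
      linarith
    exact min_eq_left (le_max_of_le_left this)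

lemma IsCentredLevyProcess.jumpSum_moments_of_tendsto [IsProbabilityMeasure P]
    (hX : IsCentredLevyProcess X ℱ P) {g : ℕ → EuclideanSpace ℝ (Fin n) → ℝ}
    {f : EuclideanSpace ℝ (Fin n) → ℝ} {ε C : ℝ} (hg : ∀ j, IsTest (g j) ε C)
    (hgf : ∀ y, Tendsto (fun j => g j y) atTop (𝓝 (f y))) (t : ℝ≥0) :
    Integrable f (levyMeasure X P) ∧ MemLp (fun ω => jumpSum f (fun s => X s ω) 0 t) 2 P ∧
      ∫ ω, jumpSum f (fun s => X s ω) 0 t ∂P = t * ∫ y, f y ∂(levyMeasure X P) ∧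
      ∫ ω, (jumpSum f (fun s => X s ω) 0 t - t * ∫ y, f y ∂(levyMeasure X P)) ^ 2 ∂P ≤
        t * ∫ y, f y ^ 2 ∂(levyMeasure X P) := by
  have hε := (hg 0).pos
  have hC := (hg 0).nonneg
  obtain ⟨φ, hφi, hφ0, hφ1⟩ := hX.integrable_cutoff hε
  have hgφ : ∀ j y, ‖g j y‖ ≤ C * φ y := fun j y => by
    rcases lt_or_ge ‖y‖ ε with h | h
    · rw [(hg j).eq_zero y h, norm_zero]; exact mul_nonneg hC (hφ0 y)
    · rw [hφ1 y h, mul_one]; exact (hg j).norm_le y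
  have hgφ2 : ∀ j y, ‖g j y ^ 2‖ ≤ C ^ 2 * φ y := fun j y => by
    rcases lt_or_ge ‖y‖ ε with h | h
    · rw [(hg j).eq_zero y h, zero_pow two_ne_zero, norm_zero]
      exact mul_nonneg (sq_nonneg C) (hφ0 y)
    · rw [hφ1 y h, mul_one]; exact (hg j).sq.norm_le y
  have hgm : ∀ j, AEStronglyMeasurable (g j) (levyMeasure X P) := fun j =>
    (hg j).continuous.aestronglyMeasurable
  have hfm : AEStronglyMeasurable f (levyMeasure X P) :=
    aestronglyMeasurable_of_tendsto_ae atTop hgm (Eventually.of_forall hgf)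
  have hfi : Integrable f (levyMeasure X P) := (hφi.const_mul C).mono' hfm
    (Eventually.of_forall fun y => le_of_tendsto' (hgf y).norm fun j => hgφ j y)
  have hlim1 : Tendsto (fun j => ∫ y, g j y ∂(levyMeasure X P)) atTop
      (𝓝 (∫ y, f y ∂(levyMeasure X P))) :=
    tendsto_integral_of_dominated_convergence _ hgm (hφi.const_mul C)
      (fun j => Eventually.of_forall (hgφ j)) (Eventually.of_forall hgf)
  have hlim2 : Tendsto (fun j => ∫ y, g j y ^ 2 ∂(levyMeasure X P)) atTop
      (𝓝 (∫ y, f y ^ 2 ∂(levyMeasure X P))) :=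
    tendsto_integral_of_dominated_convergence _ (fun j => (hgm j).pow 2) (hφi.const_mul (C ^ 2))
      (fun j => Eventually.of_forall (hgφ2 j)) (Eventually.of_forall fun y => (hgf y).pow 2)
  have hS : ∀ᵐ ω ∂P, Tendsto (fun j => jumpSum (g j) (fun s => X s ω) 0 t) atTop
      (𝓝 (jumpSum f (fun s => X s ω) 0 t)) := Eventually.of_forall fun ω =>
    (hX.cadlag ω).tendsto_jumpSum hε (fun j => (hg j).eq_zero) hgf 0 t
  have hmem : ∀ j, MemLp (fun ω => jumpSum (g j) (fun s => X s ω) 0 t) 2 P := fun j =>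
    (hX.variance_jumpSum_le (hg j) t).1
  have hmean : ∀ j, ∫ ω, jumpSum (g j) (fun s => X s ω) 0 t ∂P =
      t * ∫ y, g j y ∂(levyMeasure X P) := fun j => (hX.integral_jumpSum (hg j) t).2
  set I := ∫ y, φ y ∂(levyMeasure X P)
  have hK : ∀ j, ∫ ω, jumpSum (g j) (fun s => X s ω) 0 t ^ 2 ∂P ≤
      t * (C ^ 2 * I) + (t * (C * I)) ^ 2 := by
    intro j
    have h1 := variance_eq_sub (hmem j)
    rw [variance_eq_integral (hmem j).1.aemeasurable, hmean j] at h1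
    have h2 := (hX.variance_jumpSum_le (hg j) t).2
    have h3 : ∫ y, g j y ^ 2 ∂(levyMeasure X P) ≤ C ^ 2 * I := by
      rw [← integral_const_mul]
      exact (le_abs_self _).trans (norm_integral_le_of_norm_le (hφi.const_mul _)
        (Eventually.of_forall (hgφ2 j)))
    have h4 : |∫ y, g j y ∂(levyMeasure X P)| ≤ C * I := by
      rw [← integral_const_mul]
      exact norm_integral_le_of_norm_le (hφi.const_mul _) (Eventually.of_forall (hgφ j))
    have h5 : (t * ∫ y, g j y ∂(levyMeasure X P)) ^ 2 ≤ (t * (C * I)) ^ 2 := by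
      rw [← sq_abs, abs_mul, abs_of_nonneg t.coe_nonneg]
      gcongr
    have h6 : t * ∫ y, g j y ^ 2 ∂(levyMeasure X P) ≤ t * (C ^ 2 * I) := by gcongr
    simp only [Pi.pow_apply] at h1
    linarith
  refine ⟨hfi, (memLp_two_of_tendsto_ae hmem hK tendsto_const_nhds hS).1, ?_, ?_⟩
  · refine tendsto_nhds_unique (tendsto_integral_of_sq_le hmem hK hS) ?_
    simp_rw [hmean]
    exact hlim1.const_mul _
  · refine (memLp_two_of_tendsto_ae
      (Y := fun j ω => jumpSum (g j) (fun s => X s ω) 0 t - t * ∫ y, g j y ∂(levyMeasure X P))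
      (fun j => (hmem j).sub (memLp_const _))
      (fun j => (hX.variance_jumpSum_le (hg j) t).2) (hlim2.const_mul _) ?_).2
    filter_upwards [hS] with ω hω
    exact hω.sub (hlim1.const_mul _)

/-- The shell `{y | a < ‖y‖ ≤ b}`. -/
def shell (n : ℕ) (a b : ℝ) : Set (EuclideanSpace ℝ (Fin n)) := {y | a < ‖y‖ ∧ ‖y‖ ≤ b}

lemma measurableSet_shell (n : ℕ) (a b : ℝ) : MeasurableSet (shell n a b) :=
  (measurableSet_lt measurable_const measurable_norm).inter
    (measurableSet_le measurable_norm measurable_const)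

/-- The identity, truncated to the shell `{y | a < ‖y‖ ≤ b}`. -/
def trunc (n : ℕ) (a b : ℝ) : EuclideanSpace ℝ (Fin n) → EuclideanSpace ℝ (Fin n) :=
  (shell n a b).indicator id

lemma trunc_eq_zero {a b : ℝ} (y : EuclideanSpace ℝ (Fin n)) (hy : ‖y‖ < a) : trunc n a b y = 0 :=
  Set.indicator_of_notMem (fun h => lt_asymm h.1 hy) _

lemma stronglyMeasurable_trunc (n : ℕ) (a b : ℝ) : StronglyMeasurable (trunc n a b) :=
  stronglyMeasurable_id.indicator (measurableSet_shell n a b)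

lemma trunc_sub {a b c : ℝ} (hab : a ≤ b) (hbc : b ≤ c) (y : EuclideanSpace ℝ (Fin n)) :
    trunc n a c y - trunc n b c y = trunc n a b y := by
  classical
  simp only [trunc, shell, Set.indicator_apply, Set.mem_ofPred_eq, id]
  rcases le_or_gt ‖y‖ a with h1 | h1
  · simp [not_lt.2 h1, not_lt.2 (h1.trans hab)]
  rcases le_or_gt ‖y‖ b with h2 | h2
  · simp [h1, h2, h2.trans hbc, not_lt.2 h2]
  · simp [h1, h2, not_le.2 h2]

/-- Continuous approximations of `trunc`. -/
def truncApprox (n : ℕ) (a b : ℝ) (j : ℕ) (y : EuclideanSpace ℝ (Fin n)) :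
    EuclideanSpace ℝ (Fin n) :=
  (min 1 (max ((j + 1) * (‖y‖ - a)) 0) - min 1 (max ((j + 1) * (‖y‖ - b)) 0)) • y

lemma isTest_truncApprox {a b : ℝ} (ha : 0 < a) (hab : a ≤ b) (j : ℕ) :
    IsTest (truncApprox n a b j) a (b + 1) where
  continuous := by unfold truncApprox; fun_prop
  pos := ha
  norm_le y := by
    have hj : (0 : ℝ) < (j : ℝ) + 1 := by positivity
    set u := min (1 : ℝ) (max ((j + 1) * (‖y‖ - a)) 0) with hu
    set v := min (1 : ℝ) (max ((j + 1) * (‖y‖ - b)) 0) with hv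
    have hu1 : u ≤ 1 := min_le_left _ _
    have hv0 : 0 ≤ v := le_min zero_le_one (le_max_right _ _)
    have hvu : v ≤ u := by
      rw [hu, hv]; gcongr
    rw [truncApprox, norm_smul, ← hu, ← hv, Real.norm_of_nonneg (sub_nonneg.2 hvu)]
    rcases le_or_gt ‖y‖ (b + 1) with h | h
    · calc (u - v) * ‖y‖ ≤ 1 * ‖y‖ := by gcongr; linarith
        _ ≤ b + 1 := by rwa [one_mul]
    -- Beyond `b + 1` both cutoffs equal 1 for every `j`, so the factor of `y` vanishes and the
    -- bound is uniform in `j`.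
    · have hv1 : v = 1 := by
        refine min_eq_left (le_max_of_le_left ?_)
        have : (0 : ℝ) ≤ j := j.cast_nonneg
        nlinarith
      have : u - v = 0 := by linarith
      rw [this, zero_mul]; linarith
  eq_zero y hy := by
    have hj : (0 : ℝ) < (j : ℝ) + 1 := by positivity
    have h1 : ((j : ℝ) + 1) * (‖y‖ - a) ≤ 0 := by nlinarith
    have h2 : ((j : ℝ) + 1) * (‖y‖ - b) ≤ 0 := by nlinarith
    rw [truncApprox, max_eq_right h1, max_eq_right h2, sub_self, zero_smul]

lemma tendsto_min_max (r : ℝ) :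
    Tendsto (fun j : ℕ => min (1 : ℝ) (max ((j + 1) * r) 0)) atTop (𝓝 (if 0 < r then 1 else 0)) := by
  split_ifs with h
  · refine tendsto_const_nhds.congr' ?_
    have := (tendsto_natCast_atTop_atTop (R := ℝ)).atTop_mul_const h
    filter_upwards [this.eventually_ge_atTop 1] with j hj
    exact (min_eq_left (le_max_of_le_left (by nlinarith))).symm
  · refine tendsto_const_nhds.congr fun j => ?_
    have hj : (0 : ℝ) < (j : ℝ) + 1 := by positivity
    have : ((j : ℝ) + 1) * r ≤ 0 := by nlinarith [not_lt.1 h]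
    rw [max_eq_right this, min_eq_right zero_le_one]

lemma tendsto_truncApprox {a b : ℝ} (hab : a ≤ b) (y : EuclideanSpace ℝ (Fin n)) :
    Tendsto (fun j => truncApprox n a b j y) atTop (𝓝 (trunc n a b y)) := by
  classical
  have h := ((tendsto_min_max (‖y‖ - a)).sub (tendsto_min_max (‖y‖ - b))).smul_const y
  suffices e : trunc n a b y = ((if 0 < ‖y‖ - a then (1 : ℝ) else 0) -
      if 0 < ‖y‖ - b then 1 else 0) • y by rw [e]; exact h
  simp only [trunc, shell, Set.indicator_apply, Set.mem_ofPred_eq, id, sub_pos]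
  rcases le_or_gt ‖y‖ a with h1 | h1
  · simp [not_lt.2 h1, not_lt.2 (h1.trans hab)]
  rcases le_or_gt ‖y‖ b with h2 | h2
  · simp [h1, h2, not_lt.2 h2]
  · simp [h1, h2, not_le.2 h2]

/-- The compensated sum of the jumps in the shell `{y | a < ‖y‖ ≤ b}`. -/
def shellMartingale (X : ℝ≥0 → Ω → EuclideanSpace ℝ (Fin n)) (P : Measure Ω) (a b : ℝ) (t : ℝ≥0)
    (ω : Ω) : EuclideanSpace ℝ (Fin n) :=
  jumpSum (trunc n a b) (fun s => X s ω) 0 t - (t : ℝ) • ∫ y, trunc n a b y ∂(levyMeasure X P)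

lemma compensatedJumpSum_shell (hc : ∀ ω, IsCadlag fun t => X t ω) {a b : ℝ} (ha : 0 < a)
    (t : ℝ≥0) (ω : Ω) :
    compensatedJumpSum X P {x | a < ‖x‖ ∧ ‖x‖ ≤ b} t ω = shellMartingale X P a b t ω := by
  have e : ∀ μ : Measure (EuclideanSpace ℝ (Fin n)),
      ∫ x in {x | a < ‖x‖ ∧ ‖x‖ ≤ b}, x ∂μ = ∫ x, trunc n a b x ∂μ := fun μ =>
    (integral_indicator (measurableSet_shell n a b)).symm
  rw [compensatedJumpSum, shellMartingale, e, e, (hc ω).integral_jumpMeasure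
    (stronglyMeasurable_trunc n a b) ha trunc_eq_zero]

lemma IsCadlag.jumpSum_apply {x : ℝ≥0 → EuclideanSpace ℝ (Fin n)} (hx : IsCadlag x)
    {f : EuclideanSpace ℝ (Fin n) → EuclideanSpace ℝ (Fin n)} {ε : ℝ} (hε : 0 < ε)
    (hf : ∀ y, ‖y‖ < ε → f y = 0) (a b : ℝ≥0) (i : Fin n) :
    jumpSum f x a b i = jumpSum (fun y => f y i) x a b := by
  rw [hx.jumpSum_eq_sum hε hf, hx.jumpSum_eq_sum hε fun y hy => by rw [hf y hy]; rfl]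
  simp

lemma IsCentredLevyProcess.measurable_jumpSum_trunc (hX : IsCentredLevyProcess X ℱ P) {a b : ℝ}
    (ha : 0 < a) (hab : a ≤ b) {m : MeasurableSpace Ω} {s t : ℝ≥0} (hst : s ≤ t)
    (hm : ∀ u v, s ≤ u → u ≤ v → v ≤ t → Measurable[m] fun ω => X v ω - X u ω) :
    Measurable[m] fun ω => jumpSum (trunc n a b) (fun s => X s ω) s t :=
  measurable_of_tendsto_metrizable (fun j => measurable_jumpSum hX.cadlag
    (isTest_truncApprox ha hab j).continuous ha (isTest_truncApprox ha hab j).eq_zero hst hm)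
    (tendsto_pi_nhds.2 fun ω => (hX.cadlag ω).tendsto_jumpSum ha
      (fun j => (isTest_truncApprox ha hab j).eq_zero) (tendsto_truncApprox hab) s t)

variable [IsProbabilityMeasure P] {a b : ℝ}

lemma IsCentredLevyProcess.trunc_moments (hX : IsCentredLevyProcess X ℱ P) (ha : 0 < a)
    (hab : a ≤ b) (t : ℝ≥0) (i : Fin n) :
    Integrable (fun y => trunc n a b y i) (levyMeasure X P) ∧
      MemLp (fun ω => jumpSum (fun y => trunc n a b y i) (fun s => X s ω) 0 t) 2 P ∧
      ∫ ω, jumpSum (fun y => trunc n a b y i) (fun s => X s ω) 0 t ∂P =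
        t * ∫ y, trunc n a b y i ∂(levyMeasure X P) ∧
      ∫ ω, (jumpSum (fun y => trunc n a b y i) (fun s => X s ω) 0 t -
        t * ∫ y, trunc n a b y i ∂(levyMeasure X P)) ^ 2 ∂P ≤
        t * ∫ y, trunc n a b y i ^ 2 ∂(levyMeasure X P) := by
  refine hX.jumpSum_moments_of_tendsto (g := fun j y => truncApprox n a b j y i) (ε := a)
    (C := b + 1) (fun j => ?_) (fun y => ?_) t
  · have h := isTest_truncApprox (n := n) ha hab j
    exact
      { continuous := by have := h.continuous; fun_prop
        pos := ha
        norm_le := fun y => (PiLp.norm_apply_le _ i).trans (h.norm_le y)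
        eq_zero := fun y hy => by rw [h.eq_zero y hy]; rfl }
  · have hc : Continuous fun y : EuclideanSpace ℝ (Fin n) => y i := by fun_prop
    exact (hc.tendsto _).comp (tendsto_truncApprox hab y)

lemma IsCentredLevyProcess.integrable_trunc (hX : IsCentredLevyProcess X ℱ P) (ha : 0 < a)
    (hab : a ≤ b) : Integrable (trunc n a b) (levyMeasure X P) :=
  integrable_piLp_iff.2 fun i => (hX.trunc_moments ha hab 0 i).1

lemma IsCentredLevyProcess.shellMartingale_apply (hX : IsCentredLevyProcess X ℱ P) (ha : 0 < a)
    (hab : a ≤ b) (t : ℝ≥0) (i : Fin n) (ω : Ω) :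
    shellMartingale X P a b t ω i = jumpSum (fun y => trunc n a b y i) (fun s => X s ω) 0 t -
        t * ∫ y, trunc n a b y i ∂(levyMeasure X P) := by
  rw [shellMartingale, PiLp.sub_apply, (hX.cadlag ω).jumpSum_apply ha trunc_eq_zero,
    PiLp.smul_apply, eval_integral_piLp fun i => (hX.trunc_moments ha hab t i).1, smul_eq_mul]

lemma IsCentredLevyProcess.memLp_shellMartingale (hX : IsCentredLevyProcess X ℱ P) (ha : 0 < a)
    (hab : a ≤ b) (t : ℝ≥0) : MemLp (shellMartingale X P a b t) 2 P := by
  refine memLp_piLp_iff.2 fun i => ?_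
  simp_rw [hX.shellMartingale_apply ha hab]
  exact (hX.trunc_moments ha hab t i).2.1.sub (memLp_const _)

lemma IsCentredLevyProcess.integral_shellMartingale (hX : IsCentredLevyProcess X ℱ P) (ha : 0 < a)
    (hab : a ≤ b) (t : ℝ≥0) : ∫ ω, shellMartingale X P a b t ω ∂P = 0 := by
  have hi := (hX.memLp_shellMartingale ha hab t).integrable (by norm_num)
  ext i
  rw [eval_integral_piLp (integrable_piLp_iff.1 hi)]
  simp_rw [hX.shellMartingale_apply ha hab]
  have h := hX.trunc_moments ha hab t i
  rw [integral_sub (h.2.1.integrable (by norm_num)) (integrable_const _), h.2.2.1]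
  simp

lemma IsCentredLevyProcess.eLpNorm_shellMartingale_le (hX : IsCentredLevyProcess X ℱ P)
    (ha : 0 < a) (hab : a ≤ b) (t : ℝ≥0) :
    eLpNorm (shellMartingale X P a b t) 2 P ^ 2 ≤
      t * ∫⁻ y in shell n a b, ‖y‖ₑ ^ 2 ∂(levyMeasure X P) := by
  have hm := hX.memLp_shellMartingale ha hab t
  have e1 : eLpNorm (shellMartingale X P a b t) 2 P ^ 2 =
      ENNReal.ofReal (∫ ω, ‖shellMartingale X P a b t ω‖ ^ 2 ∂P) := by
    rw [ofReal_integral_eq_lintegral_ofReal ((memLp_two_iff_integrable_sq_norm hm.1).1 hm)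
      (Eventually.of_forall fun _ => by positivity)]
    have := eLpNorm_nnreal_pow_eq_lintegral (μ := P) (f := shellMartingale X P a b t)
      (p := 2) two_ne_zero
    simp only [NNReal.coe_ofNat, ENNReal.coe_ofNat, ENNReal.rpow_ofNat] at this
    rw [this]
    exact lintegral_congr fun ω => by rw [ENNReal.ofReal_pow (norm_nonneg _), ofReal_norm]
  have hsq : ∀ i, Integrable (fun y => trunc n a b y i ^ 2) (levyMeasure X P) := by
    intro i
    refine ((hX.trunc_moments ha hab t i).1.norm.const_mul b).mono' ?_ ?_
    · exact (hX.trunc_moments ha hab t i).1.1.pow 2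
    · refine Eventually.of_forall fun y => ?_
      rw [norm_pow, sq]
      gcongr
      refine (PiLp.norm_apply_le _ i).trans ?_
      by_cases hy : y ∈ shell n a b
      · rw [trunc, Set.indicator_of_mem hy]; exact hy.2
      · rw [trunc, Set.indicator_of_notMem hy, norm_zero]; linarith
  have e2 : ∫⁻ y in shell n a b, ‖y‖ₑ ^ 2 ∂(levyMeasure X P) =
      ENNReal.ofReal (∫ y, ‖trunc n a b y‖ ^ 2 ∂(levyMeasure X P)) := by
    rw [ofReal_integral_eq_lintegral_ofReal ?_ (Eventually.of_forall fun _ => by positivity),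
      ← lintegral_indicator (measurableSet_shell n a b)]
    · refine lintegral_congr fun y => ?_
      rw [ENNReal.ofReal_pow (norm_nonneg _), ofReal_norm]
      by_cases hy : y ∈ shell n a b
      · rw [trunc, Set.indicator_of_mem hy, Set.indicator_of_mem hy]; rfl
      · rw [trunc, Set.indicator_of_notMem hy, Set.indicator_of_notMem hy]; simp
    · simp_rw [EuclideanSpace.real_norm_sq_eq]
      exact integrable_finsetSum _ fun i _ => hsq i
  rw [e1, e2, ← ENNReal.ofReal_coe_nnreal, ← ENNReal.ofReal_mul t.coe_nonneg]
  refine ENNReal.ofReal_le_ofReal ?_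
  simp_rw [EuclideanSpace.real_norm_sq_eq]
  rw [integral_finsetSum _ fun i _ => (memLp_piLp_iff.1 hm i).integrable_sq,
    integral_finsetSum _ fun i _ => hsq i, Finset.mul_sum]
  refine Finset.sum_le_sum fun i _ => ?_
  simp_rw [hX.shellMartingale_apply ha hab]
  exact (hX.trunc_moments ha hab t i).2.2.2

lemma IsCentredLevyProcess.shellMartingale_sub (hX : IsCentredLevyProcess X ℱ P) (ha : 0 < a)
    (hab : a ≤ b) {c : ℝ} (hbc : b ≤ c) (t : ℝ≥0) (ω : Ω) :
    shellMartingale X P a c t ω - shellMartingale X P b c t ω = shellMartingale X P a b t ω := by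
  have hb := ha.trans_le hab
  simp only [shellMartingale]
  simp_rw [← trunc_sub hab hbc]
  have h1 : jumpSum (trunc n a b) (fun s => X s ω) 0 t = jumpSum (trunc n a c) (fun s => X s ω) 0 t
      - jumpSum (trunc n b c) (fun s => X s ω) 0 t := by
    rw [← (hX.cadlag ω).jumpSum_sub ha trunc_eq_zero
      (fun y hy => trunc_eq_zero y (hy.trans_le hab))]
    congr 1
    ext1 y
    exact (trunc_sub hab hbc y).symm
  rw [h1, integral_sub (hX.integrable_trunc ha (hab.trans hbc)) (hX.integrable_trunc hb hbc),
    smul_sub]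
  abel

/-- An increment measurable with respect to the future is independent of `ℱ s`, so its conditional
expectation is its mean, which is 0. -/
lemma IsCentredLevyProcess.martingale_of_increments (hX : IsCentredLevyProcess X ℱ P)
    {Z : ℝ≥0 → Ω → EuclideanSpace ℝ (Fin n)} (hZ : ∀ t, Measurable[ℱ t] (Z t))
    (hZi : ∀ t, Integrable (Z t) P) (hZ0 : ∀ t, ∫ ω, Z t ω ∂P = 0)
    (hZm : ∀ s t, s ≤ t → Measurable[futureIncrements X s] fun ω => Z t ω - Z s ω) :
    Martingale Z ℱ P := by
  refine ⟨fun t => (hZ t).stronglyMeasurable, fun s t hst => ?_⟩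
  have h1 : P[fun ω => Z t ω - Z s ω|ℱ s] =ᵐ[P] fun _ => ∫ ω, (Z t ω - Z s ω) ∂P :=
    condExp_indep_eq (hX.futureIncrements_le s) (ℱ.le s) (hZm s t hst).stronglyMeasurable
      (hX.indep_futureIncrements s)
  rw [integral_sub (hZi t) (hZi s), hZ0, hZ0, sub_zero] at h1
  have h2 : Z t = (fun ω => Z t ω - Z s ω) + Z s := by ext1 ω; simp
  have h3 := condExp_add ((hZi t).sub (hZi s)) (hZi s) (ℱ s)
  have h4 : P[Z s|ℱ s] = Z s :=
    condExp_of_stronglyMeasurable (ℱ.le s) (hZ s).stronglyMeasurable (hZi s)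
  rw [h2]
  filter_upwards [h1, h3] with ω e1 e3
  refine e3.trans ?_
  rw [Pi.add_apply, h4]
  refine (congrArg (· + Z s ω) e1).trans ?_
  simp

lemma IsCentredLevyProcess.martingale (hX : IsCentredLevyProcess X ℱ P) : Martingale X ℱ P :=
  hX.martingale_of_increments hX.adapted (fun t => (hX.memLp t).integrable (by norm_num)) hX.centred
    fun _ _ hst => measurable_futureIncrements X le_rfl hst

lemma IsCentredLevyProcess.martingale_shellMartingale (hX : IsCentredLevyProcess X ℱ P)
    (ha : 0 < a) (hab : a ≤ b) : Martingale (shellMartingale X P a b) ℱ P := by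
  refine hX.martingale_of_increments (fun t => ?_)
    (fun t => (hX.memLp_shellMartingale ha hab t).integrable (by norm_num))
    (hX.integral_shellMartingale ha hab) (fun s t hst => ?_)
  · exact (hX.measurable_jumpSum_trunc ha hab zero_le fun u v _ huv hv =>
      ((hX.adapted v).mono (ℱ.mono hv) le_rfl).sub
        ((hX.adapted u).mono (ℱ.mono (huv.trans hv)) le_rfl)).sub_const _
  · have h := hX.measurable_jumpSum_trunc ha hab hst (m := futureIncrements X s) fun u v hu huv hv =>
      measurable_futureIncrements X hu (hu.trans huv)
    have h' := h.sub_const (((t : ℝ) - s) • ∫ y, trunc n a b y ∂(levyMeasure X P))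
    convert h' using 1
    ext1 ω
    simp only [shellMartingale]
    rw [← (hX.cadlag ω).jumpSum_add ha trunc_eq_zero zero_le hst, sub_smul]
    abel

end Truncation

/-! ### `L¹` limits of martingales and Doob's maximal inequality -/

section Martingales

variable {n : ℕ} {Ω : Type*} {mΩ : MeasurableSpace Ω} {P : Measure Ω}
  {ℱ : Filtration ℝ≥0 mΩ}

/-- Conditional expectation contracts `L¹`, so the martingale identity survives the limit. -/
lemma martingale_of_tendsto_eLpNorm {E : Type*} [NormedAddCommGroup E] [NormedSpace ℝ E]
    [CompleteSpace E] {M : ℕ → ℝ≥0 → Ω → E} {Z : ℝ≥0 → Ω → E} (hM : ∀ j, Martingale (M j) ℱ P)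
    (hZ : ∀ t, StronglyMeasurable[ℱ t] (Z t)) (hZi : ∀ t, Integrable (Z t) P)
    (hlim : ∀ t, Tendsto (fun j => eLpNorm (M j t - Z t) 1 P) atTop (𝓝 0)) : Martingale Z ℱ P := by
  refine ⟨hZ, fun s t hst => ?_⟩
  have hle : ∀ j, eLpNorm (P[Z t|ℱ s] - Z s) 1 P ≤
      eLpNorm (M j t - Z t) 1 P + eLpNorm (M j s - Z s) 1 P := by
    intro j
    have e : P[Z t|ℱ s] - Z s =ᵐ[P] (M j s - Z s) - P[M j t - Z t|ℱ s] := by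
      filter_upwards [condExp_sub ((hM j).integrable t) (hZi t) (ℱ s), (hM j).2 s t hst]
        with ω h1 h2
      simp only [Pi.sub_apply] at h1 ⊢
      rw [h1, h2]
      abel
    rw [eLpNorm_congr_ae e]
    refine (eLpNorm_sub_le (((hM j).integrable s).sub (hZi s)).1 integrable_condExp.1 le_rfl).trans ?_
    rw [add_comm]
    gcongr
    exact eLpNorm_condExp_le_eLpNorm _ le_rfl
  have h0 : eLpNorm (P[Z t|ℱ s] - Z s) 1 P ≤ 0 := by
    have := (hlim t).add (hlim s)
    rw [add_zero] at this
    exact ge_of_tendsto' this hle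
  have h1 := (eLpNorm_eq_zero_iff (integrable_condExp.sub (hZi s)).1 one_ne_zero).1
    (le_antisymm h0 zero_le)
  filter_upwards [h1] with ω hω
  exact sub_eq_zero.1 hω

/-- Doob's maximal inequality on the dyadic grid. -/
lemma mul_measure_gridExceeds_le [IsProbabilityMeasure P]
    {D : ℝ≥0 → Ω → EuclideanSpace ℝ (Fin n)} (hD : Martingale D ℱ P)
    (T : ℝ≥0) (r : ℝ≥0) (j : ℕ) : r * P (gridExceeds D T r j) ≤ eLpNorm (D T) 1 P := by
  have hmono : Monotone fun k : ℕ => (k : ℝ≥0) * (T / (2 ^ j : ℕ)) := fun i k hik => by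
    dsimp only; gcongr
  let 𝒢 : Filtration ℕ mΩ :=
    { seq := fun k => ℱ ((k : ℕ) * (T / (2 ^ j : ℕ)))
      mono' := fun i k hik => ℱ.mono (hmono hik)
      le' := fun k => ℱ.le _ }
  have hsub : Submartingale (fun k ω => ‖D ((k : ℕ) * (T / (2 ^ j : ℕ))) ω‖) 𝒢 P := by
    refine ⟨fun k => (hD.1 _).norm, fun i k hik => ?_, fun k => (hD.integrable _).norm⟩
    filter_upwards [hD.2 _ _ (hmono hik), norm_condExp_le (m := ℱ ((i : ℕ) * (T / (2 ^ j : ℕ))))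
      (μ := P) (D ((k : ℕ) * (T / (2 ^ j : ℕ))))] with ω h1 h2
    rw [h1] at h2
    exact h2
  have hmax := maximal_ineq hsub (fun k ω => norm_nonneg _) (ε := r) (2 ^ j)
  have hT : ((2 ^ j : ℕ) : ℝ≥0) * (T / (2 ^ j : ℕ)) = T := mul_div_cancel₀ _ (by simp)
  calc r * P (gridExceeds D T r j) ≤ r * P {ω | (r : ℝ) ≤ (Finset.range (2 ^ j + 1)).sup'
        Finset.nonempty_range_add_one fun k => ‖D ((k : ℕ) * (T / (2 ^ j : ℕ))) ω‖} := by
        gcongr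
        rintro ω ⟨k, hk, h⟩
        change (r : ℝ) ≤ (Finset.range (2 ^ j + 1)).sup' _ _
        exact (Finset.le_sup'_iff _).2 ⟨k, Finset.mem_range.2 (Nat.lt_succ_of_le hk), h.le⟩
    _ ≤ _ := hmax
    _ ≤ ENNReal.ofReal (∫ ω, ‖D ((2 ^ j : ℕ) * (T / (2 ^ j : ℕ))) ω‖ ∂P) :=
        ENNReal.ofReal_le_ofReal (setIntegral_le_integral (hD.integrable _).norm
          (Eventually.of_forall fun _ => norm_nonneg _))
    _ = eLpNorm (D T) 1 P := by
        rw [hT, eLpNorm_one_eq_lintegral_enorm, ofReal_integral_norm_eq_lintegral_enorm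
          (hD.integrable _)]

/-- Rounding `s` up to the grid gives times in `[s, T]` converging to `s` from the right, where
right-continuity applies. -/
lemma exists_gridExceeds {x : ℝ≥0 → Ω → EuclideanSpace ℝ (Fin n)} {ω : Ω}
    (hx : ∀ t, ContinuousWithinAt (fun t => x t ω) (Set.Ici t) t) {T s : ℝ≥0} (hs : s ≤ T) {r : ℝ}
    (hr : r < ‖x s ω‖) : ∃ j, ω ∈ gridExceeds x T r j := by
  rcases eq_or_ne T 0 with rfl | hT
  · obtain rfl : s = 0 := le_antisymm hs zero_le
    exact ⟨0, 0, by simp, by simpa using hr⟩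
  have hδ : ∀ j : ℕ, 0 < T / (2 ^ j : ℕ) := fun j => div_pos (pos_iff_ne_zero.2 hT) (by simp)
  let k : ℕ → ℕ := fun j => ⌈s / (T / (2 ^ j : ℕ))⌉₊
  have hk1 : ∀ j, s ≤ k j * (T / (2 ^ j : ℕ)) := fun j => by
    rw [← div_le_iff₀ (hδ j)]; exact Nat.le_ceil _
  have hk2 : ∀ j, k j * (T / (2 ^ j : ℕ)) ≤ s + T / (2 ^ j : ℕ) := fun j => by
    have := (Nat.ceil_lt_add_one (show 0 ≤ s / (T / (2 ^ j : ℕ)) from zero_le)).le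
    calc k j * (T / (2 ^ j : ℕ)) ≤ (s / (T / (2 ^ j : ℕ)) + 1) * (T / (2 ^ j : ℕ)) := by gcongr
      _ = s + T / (2 ^ j : ℕ) := by rw [add_mul, one_mul, div_mul_cancel₀ _ (hδ j).ne']
  have hk3 : ∀ j, k j ≤ 2 ^ j := fun j => by
    refine Nat.ceil_le.2 ?_
    rw [div_le_iff₀ (hδ j), mul_div_cancel₀ _ (by simp)]
    exact hs
  have hlim0 : Tendsto (fun j : ℕ => T / ((2 ^ j : ℕ) : ℝ≥0)) atTop (𝓝 0) := by
    have : Tendsto (fun j : ℕ => T * (2⁻¹ : ℝ≥0) ^ j) atTop (𝓝 (T * 0)) :=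
      (NNReal.tendsto_pow_atTop_nhds_zero_of_lt_one (by
        rw [← NNReal.coe_lt_coe]; push_cast; norm_num)).const_mul T
    rw [mul_zero] at this
    refine this.congr fun j => ?_
    push_cast
    rw [inv_pow, div_eq_mul_inv]
  have hlim : Tendsto (fun j => (k j : ℝ≥0) * (T / (2 ^ j : ℕ))) atTop (𝓝[≥] s) := by
    refine tendsto_nhdsWithin_iff.2 ⟨?_, Eventually.of_forall hk1⟩
    refine tendsto_of_tendsto_of_tendsto_of_le_of_le tendsto_const_nhds ?_ hk1 hk2
    simpa using hlim0.const_add s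
  have := ((hx s).tendsto.comp hlim).norm.eventually (Ioi_mem_nhds hr)
  obtain ⟨j, hj⟩ := this.exists
  exact ⟨j, k j, hk3 j, hj⟩

/-- Doob's maximal inequality for right-continuous martingales. -/
lemma mul_measure_exists_norm_gt_le [IsProbabilityMeasure P]
    {D : ℝ≥0 → Ω → EuclideanSpace ℝ (Fin n)}
    (hD : Martingale D ℱ P) (hc : ∀ ω t, ContinuousWithinAt (fun t => D t ω) (Set.Ici t) t)
    (T r : ℝ≥0) : r * P {ω | ∃ s ≤ T, r < ‖D s ω‖} ≤ eLpNorm (D T) 1 P := by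
  have hsub : {ω | ∃ s ≤ T, r < ‖D s ω‖} ⊆ ⋃ j, gridExceeds D T r j := by
    rintro ω ⟨s, hs, h⟩
    exact Set.mem_iUnion.2 (exists_gridExceeds (hc ω) hs h)
  have hlim : Tendsto (fun j => r * P (gridExceeds D T r j)) atTop
      (𝓝 (r * P (⋃ j, gridExceeds D T r j))) :=
    ENNReal.Tendsto.const_mul (tendsto_measure_iUnion_atTop (gridExceeds_mono D T r))
      (Or.inr ENNReal.coe_ne_top)
  calc r * P {ω | ∃ s ≤ T, r < ‖D s ω‖} ≤ r * P (⋃ j, gridExceeds D T r j) := by gcongr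
    _ ≤ _ := le_of_tendsto' hlim (mul_measure_gridExceeds_le hD T r)

end Martingales

/-! ### Path regularity after removing the large jumps -/

section PathsOfShell

variable {n : ℕ} {Ω : Type*} {mΩ : MeasurableSpace Ω} {P : Measure Ω}
  {X : ℝ≥0 → Ω → EuclideanSpace ℝ (Fin n)}

lemma continuousWithinAt_shellMartingale {ω : Ω} (hc : IsCadlag fun t => X t ω) {a b : ℝ}
    (ha : 0 < a) (t : ℝ≥0) :
    ContinuousWithinAt (fun t => shellMartingale X P a b t ω) (Set.Ici t) t := by
  refine ContinuousWithinAt.sub ?_ (Continuous.continuousWithinAt (by fun_prop))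
  refine tendsto_const_nhds.congr' ?_
  filter_upwards [mem_nhdsWithin_of_mem_nhds (hc.eventually_jumpSum ha
    (trunc_eq_zero (n := n) (b := b)) t), self_mem_nhdsWithin] with v hv htv
  exact (hv.1 htv).symm

lemma eventually_norm_sub_shellMartingale_lt {ω : Ω} (hc : IsCadlag fun t => X t ω) {a κ : ℝ}
    (ha : 0 < a) (hκ : a < κ) (t : ℝ≥0) (hj : ‖jump (fun s => X s ω) t‖ ≤ 1) :
    ∀ᶠ u in 𝓝 t, ‖(X u ω - shellMartingale X P a 1 u ω) -
      (X t ω - shellMartingale X P a 1 t ω)‖ < κ := by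
  -- The budget `κ` splits into `a` for a jump not removed by the truncation and `(κ - a) / 2` each
  -- for the oscillation of `X` and for the drift.
  have hη : 0 < (κ - a) / 2 := by linarith
  obtain ⟨U, hU, htU, hosc⟩ := hc.exists_isOpen_norm_sub_lt t hη
  set c := ∫ y, trunc n a 1 y ∂(levyMeasure X P) with hcdef
  have hdrift : ∀ᶠ u : ℝ≥0 in 𝓝 t, ‖(u : ℝ) • c - (t : ℝ) • c‖ < (κ - a) / 2 := by
    have : Continuous fun u : ℝ≥0 => ‖(u : ℝ) • c - (t : ℝ) • c‖ := by fun_prop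
    have h := this.tendsto t
    simp only [sub_self, norm_zero] at h
    exact h.eventually (Iio_mem_nhds hη)
  have htr : ‖jump (fun s => X s ω) t - trunc n a 1 (jump (fun s => X s ω) t)‖ ≤ a := by
    by_cases hmem : jump (fun s => X s ω) t ∈ shell n a 1
    · rw [trunc, Set.indicator_of_mem hmem]; simpa using ha.le
    · rw [trunc, Set.indicator_of_notMem hmem, sub_zero]
      by_contra h
      exact hmem ⟨not_le.1 h, hj⟩
  filter_upwards [hU.mem_nhds htU, hdrift, hc.eventually_jumpSum ha
    (trunc_eq_zero (n := n) (b := 1)) t] with u hu hd hJ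
  simp only [shellMartingale]
  rw [← hcdef]
  rcases le_or_gt t u with htu | hut
  · have h1 := (hosc t htU u hu htu).1 (Or.inr le_rfl)
    rw [hJ.1 htu]
    calc _ = ‖(X u ω - X t ω) + ((u : ℝ) • c - (t : ℝ) • c)‖ := by congr 1; abel
      _ ≤ _ := norm_add_le _ _
      _ < κ := by linarith
  · have h1 := (hosc u hu t htU hut.le).2 hut le_rfl
    rw [hJ.2 hut]
    calc _ = ‖((u : ℝ) • c - (t : ℝ) • c) - ((X t ω - X u ω - jump (fun s => X s ω) t) +
          (jump (fun s => X s ω) t - trunc n a 1 (jump (fun s => X s ω) t)))‖ := by congr 1; abel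
      _ ≤ _ := norm_sub_le _ _
      _ ≤ ‖(u : ℝ) • c - (t : ℝ) • c‖ + (‖X t ω - X u ω - jump (fun s => X s ω) t‖ +
          ‖jump (fun s => X s ω) t - trunc n a 1 (jump (fun s => X s ω) t)‖) := by
          gcongr; exact norm_add_le _ _
      _ < κ := by linarith

end PathsOfShell

/-! ### Almost sure limit of the shell martingales and the decomposition -/

section Decomposition

variable {n : ℕ} {Ω : Type*} {mΩ : MeasurableSpace Ω} {P : Measure Ω} 
  {ℱ : Filtration ℝ≥0 mΩ} {X : ℝ≥0 → Ω → EuclideanSpace ℝ (Fin n)}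

/-- The second moment of the Lévy measure on the punctured ball of radius `r`. -/
def smallJumpEnergy (X : ℝ≥0 → Ω → EuclideanSpace ℝ (Fin n)) (P : Measure Ω) (r : ℝ) : ℝ≥0∞ :=
  ∫⁻ y in shell n 0 r, ‖y‖ₑ ^ 2 ∂(levyMeasure X P)

lemma IsCentredLevyProcess.tendsto_smallJumpEnergy [IsProbabilityMeasure P]
    (hX : IsCentredLevyProcess X ℱ P) :
    Tendsto (smallJumpEnergy X P) (𝓝[>] 0) (𝓝 0) := by
  have hball : MeasurableSet {y : EuclideanSpace ℝ (Fin n) | ‖y‖ ≤ 1} :=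
    measurableSet_le measurable_norm measurable_const
  have h := tendsto_lintegral_filter_of_dominated_convergence (μ := levyMeasure X P)
    (l := 𝓝[>] (0 : ℝ)) (F := fun r => (shell n 0 r).indicator fun y => ‖y‖ₑ ^ 2) (f := fun _ => 0)
    ({y : EuclideanSpace ℝ (Fin n) | ‖y‖ ≤ 1}.indicator fun y => ‖y‖ₑ ^ 2)
    (Eventually.of_forall fun r => Measurable.indicator (by fun_prop) (measurableSet_shell n 0 r))
    ?_ ?_ ?_
  · simp only [lintegral_zero] at h
    refine h.congr fun r => lintegral_indicator (measurableSet_shell n 0 r) _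
  · filter_upwards [mem_nhdsWithin_of_mem_nhds (Iio_mem_nhds one_pos)] with r hr
    refine Eventually.of_forall fun y => Set.indicator_le_indicator_of_subset
      (fun z hz => hz.2.trans (le_of_lt hr)) (fun _ => zero_le) y
  · rw [lintegral_indicator hball]
    exact hX.lintegral_sq_lt_top.ne
  · refine Eventually.of_forall fun y => tendsto_const_nhds.congr' ?_
    by_cases hy : y = 0
    · exact Eventually.of_forall fun r => (Set.indicator_of_notMem (fun h => by
        have := h.1; simp [hy] at this) _).symm
    · filter_upwards [mem_nhdsWithin_of_mem_nhds (Iio_mem_nhds (norm_pos_iff.2 hy))] with r hr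
      exact (Set.indicator_of_notMem (fun h => not_lt.2 h.2 hr) _).symm

lemma IsCentredLevyProcess.eLpNorm_shellMartingale_sub_le [IsProbabilityMeasure P]
    (hX : IsCentredLevyProcess X ℱ P)
    {a b : ℝ} (ha : 0 < a) (hab : a ≤ b) (hb : b ≤ 1) (t : ℝ≥0) :
    eLpNorm (shellMartingale X P a 1 t - shellMartingale X P b 1 t) 2 P ^ 2 ≤
      t * smallJumpEnergy X P b := by
  have e : shellMartingale X P a 1 t - shellMartingale X P b 1 t = shellMartingale X P a b t := by
    ext1 ω
    exact hX.shellMartingale_sub ha hab hb t ω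
  rw [e]
  refine (hX.eLpNorm_shellMartingale_le ha hab t).trans ?_
  gcongr
  exact lintegral_mono_set fun y hy => ⟨ha.trans hy.1, hy.2⟩

/-- Truncation levels along which the compensated sums of jumps converge fast. -/
structure IsFastSequence (X : ℝ≥0 → Ω → EuclideanSpace ℝ (Fin n)) (P : Measure Ω) (δ : ℕ → ℝ) :
    Prop where
  pos : ∀ j, 0 < δ j
  le_one : ∀ j, δ j ≤ 1
  antitone : Antitone δ
  tendsto : Tendsto δ atTop (𝓝 0)
  energy_le : ∀ j : ℕ, j * smallJumpEnergy X P (δ j) ≤ (4⁻¹ ^ j) ^ 2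

lemma IsCentredLevyProcess.exists_isFastSequence [IsProbabilityMeasure P]
    (hX : IsCentredLevyProcess X ℱ P) :
    ∃ δ, IsFastSequence X P δ := by
  have hlim : Tendsto (fun k : ℕ => 1 / ((k : ℝ) + 1)) atTop (𝓝[>] 0) :=
    tendsto_nhdsWithin_iff.2 ⟨tendsto_one_div_add_atTop_nhds_zero_nat,
      Eventually.of_forall fun k => (by positivity : (0 : ℝ) < 1 / ((k : ℝ) + 1))⟩
  have hev : ∀ j : ℕ, ∀ᶠ k : ℕ in atTop,
      j * smallJumpEnergy X P (1 / ((k : ℝ) + 1)) ≤ (4⁻¹ ^ j) ^ 2 := by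
    intro j
    have h1 : Tendsto (fun k : ℕ => j * smallJumpEnergy X P (1 / ((k : ℝ) + 1))) atTop
        (𝓝 (j * 0)) :=
      ENNReal.Tendsto.const_mul (hX.tendsto_smallJumpEnergy.comp hlim)
        (Or.inr (ENNReal.natCast_ne_top j))
    rw [mul_zero] at h1
    have hpos : (0 : ℝ≥0∞) < (4⁻¹ ^ j) ^ 2 :=
      ENNReal.pow_pos (ENNReal.pow_pos (by simp) _) _
    exact (h1.eventually (Iio_mem_nhds hpos)).mono fun k hk => le_of_lt hk
  obtain ⟨φ, hφ, h⟩ := extraction_forall_of_eventually hev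
  refine ⟨fun j => 1 / ((φ j : ℝ) + 1), fun j => by positivity, fun j => ?_, fun i j hij => ?_, ?_, h⟩
  · rw [div_le_one (by positivity)]; simp
  · have := hφ.monotone hij
    gcongr
  · exact tendsto_one_div_add_atTop_nhds_zero_nat.comp hφ.tendsto_atTop

variable {δ : ℕ → ℝ}

/-- Doob's inequality on the growing intervals `[0, j]` and the Borel–Cantelli lemma; the factor `j`
in `IsFastSequence.energy_le` pays for the length of the interval. -/
lemma IsCentredLevyProcess.ae_eventually_norm_sub_le [IsProbabilityMeasure P]
    (hX : IsCentredLevyProcess X ℱ P)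
    (hδ : IsFastSequence X P δ) :
    ∀ᵐ ω ∂P, ∀ᶠ j : ℕ in atTop, ∀ s ≤ (j : ℝ≥0),
      ‖shellMartingale X P (δ (j + 1)) 1 s ω - shellMartingale X P (δ j) 1 s ω‖ ≤ 2⁻¹ ^ j := by
  let A : ℕ → Set Ω := fun j => {ω | ∃ s ≤ (j : ℝ≥0), ((2⁻¹ ^ j : ℝ≥0) : ℝ) <
    ‖(shellMartingale X P (δ (j + 1)) 1 - shellMartingale X P (δ j) 1) s ω‖}
  have hA : ∀ j, P (A j) ≤ 2⁻¹ ^ j := by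
    intro j
    have h1 := mul_measure_exists_norm_gt_le
      ((hX.martingale_shellMartingale (hδ.pos (j + 1)) (hδ.le_one (j + 1))).sub
        (hX.martingale_shellMartingale (hδ.pos j) (hδ.le_one j)))
      (fun ω t => (continuousWithinAt_shellMartingale (hX.cadlag ω) (hδ.pos (j + 1)) t).sub
        (continuousWithinAt_shellMartingale (hX.cadlag ω) (hδ.pos j) t)) j (2⁻¹ ^ j)
    have h2 := hX.eLpNorm_shellMartingale_sub_le (hδ.pos (j + 1)) (hδ.antitone j.le_succ)
      (hδ.le_one j) j
    have h3 := h2.trans (by simpa using hδ.energy_le j)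
    rw [ENNReal.pow_le_pow_left_iff two_ne_zero] at h3
    have h4 : eLpNorm ((shellMartingale X P (δ (j + 1)) 1 - shellMartingale X P (δ j) 1) j) 1 P ≤
        4⁻¹ ^ j := by
      refine (eLpNorm_le_eLpNorm_of_exponent_le one_le_two ?_).trans h3
      exact ((hX.memLp_shellMartingale (hδ.pos (j + 1)) (hδ.le_one (j + 1)) j).sub
        (hX.memLp_shellMartingale (hδ.pos j) (hδ.le_one j) j)).1
    -- The norm bound `4⁻¹ ^ j` splits evenly between the threshold and the probability.
    have h5 : (2⁻¹ : ℝ≥0∞) ^ j * P (A j) ≤ 2⁻¹ ^ j * 2⁻¹ ^ j := by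
      refine le_trans ?_ ((h1.trans h4).trans (le_of_eq ?_))
      · rw [ENNReal.coe_pow, ENNReal.coe_inv two_ne_zero]
        rfl
      · rw [← mul_pow, ← ENNReal.mul_inv (by simp) (by simp)]
        norm_num
    rwa [ENNReal.mul_le_mul_iff_right (by simp) (by simp)] at h5
  have hsum : ∑' j, P (A j) ≠ ∞ := by
    refine ((ENNReal.tsum_le_tsum hA).trans_lt ?_).ne
    rw [ENNReal.tsum_geometric]
    simp
  filter_upwards [ae_eventually_notMem hsum] with ω hω
  filter_upwards [hω] with j hj s hs
  by_contra h
  refine hj ⟨s, hs, ?_⟩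
  push_cast
  exact not_le.1 h

/-- The pointwise limit of the compensated sums of jumps. -/
def shellLimit (X : ℝ≥0 → Ω → EuclideanSpace ℝ (Fin n)) (P : Measure Ω) (δ : ℕ → ℝ) (t : ℝ≥0)
    (ω : Ω) : EuclideanSpace ℝ (Fin n) :=
  limUnder atTop fun j => shellMartingale X P (δ j) 1 t ω

lemma eventually_norm_sub_shellLimit_le {ω : Ω} (h : ∀ᶠ j : ℕ in atTop, ∀ s ≤ (j : ℝ≥0),
      ‖shellMartingale X P (δ (j + 1)) 1 s ω - shellMartingale X P (δ j) 1 s ω‖ ≤ 2⁻¹ ^ j)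
    (T : ℝ≥0) : ∀ᶠ j : ℕ in atTop, ∀ s ≤ T,
      ‖shellMartingale X P (δ j) 1 s ω - shellLimit X P δ s ω‖ ≤ 2 * 2⁻¹ ^ j := by
  obtain ⟨J, hJ⟩ := eventually_atTop.1 h
  obtain ⟨N, hN⟩ := exists_nat_ge T
  filter_upwards [eventually_ge_atTop (max J N)] with j hj s hs
  have hstep : ∀ k, dist (shellMartingale X P (δ (k + j)) 1 s ω)
      (shellMartingale X P (δ (k + 1 + j)) 1 s ω) ≤ (2 * 2⁻¹ ^ j) / 2 / 2 ^ k := by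
    intro k
    rw [dist_comm, dist_eq_norm, add_right_comm]
    refine (hJ (k + j) (by have := le_max_left J N; omega) s ?_).trans (le_of_eq ?_)
    · refine (hs.trans hN).trans ?_
      exact_mod_cast (le_max_right J N).trans (hj.trans (Nat.le_add_left j k))
    · rw [pow_add, inv_pow 2 k]; field_simp
  have hcauchy := cauchySeq_of_le_geometric_two
    (f := fun k => shellMartingale X P (δ (k + j)) 1 s ω) hstep
  obtain ⟨l, hl⟩ := cauchySeq_tendsto_of_complete hcauchy
  have hl' : shellLimit X P δ s ω = l := ((tendsto_add_atTop_iff_nat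
    (f := fun k => shellMartingale X P (δ k) 1 s ω) j).1 hl).limUnder_eq
  have := dist_le_of_le_geometric_two_of_tendsto
    (f := fun k => shellMartingale X P (δ (k + j)) 1 s ω) hstep hl 0
  rw [hl', ← dist_eq_norm]
  simpa using this

lemma tendsto_shellLimit {ω : Ω} (h : ∀ᶠ j : ℕ in atTop, ∀ s ≤ (j : ℝ≥0),
      ‖shellMartingale X P (δ (j + 1)) 1 s ω - shellMartingale X P (δ j) 1 s ω‖ ≤ 2⁻¹ ^ j)
    (t : ℝ≥0) : Tendsto (fun j => shellMartingale X P (δ j) 1 t ω) atTop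
      (𝓝 (shellLimit X P δ t ω)) := by
  rw [tendsto_iff_norm_sub_tendsto_zero]
  have hz : Tendsto (fun j : ℕ => 2 * (2⁻¹ : ℝ) ^ j) atTop (𝓝 0) := by
    simpa using (tendsto_pow_atTop_nhds_zero_of_lt_one (r := (2⁻¹ : ℝ)) (by norm_num)
      (by norm_num)).const_mul 2
  refine squeeze_zero' (Eventually.of_forall fun j => norm_nonneg _) ?_ hz
  filter_upwards [eventually_norm_sub_shellLimit_le h t] with j hj
  exact hj t le_rfl

/-- A three-epsilon argument: the convergence is uniform on `[0, t + 1]`, and `X` minus the `j`-th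
shell martingale oscillates near `t` by little more than `δ j`. -/
lemma continuous_sub_shellLimit {ω : Ω} (hc : IsCadlag fun t => X t ω)
    (hδ : IsFastSequence X P δ) (hj : ∀ t, ‖jump (fun s => X s ω) t‖ ≤ 1)
    (h : ∀ᶠ j : ℕ in atTop, ∀ s ≤ (j : ℝ≥0),
      ‖shellMartingale X P (δ (j + 1)) 1 s ω - shellMartingale X P (δ j) 1 s ω‖ ≤ 2⁻¹ ^ j) :
    Continuous fun t => X t ω - shellLimit X P δ t ω := by
  refine continuous_iff_continuousAt.2 fun t => Metric.tendsto_nhds.2 fun κ hκ => ?_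
  have hz : Tendsto (fun j : ℕ => 2 * (2⁻¹ : ℝ) ^ j) atTop (𝓝 0) := by
    simpa using (tendsto_pow_atTop_nhds_zero_of_lt_one (r := (2⁻¹ : ℝ)) (by norm_num)
      (by norm_num)).const_mul 2
  have hκ3 : 0 < κ / 3 := by linarith
  obtain ⟨j, h1, h2, h3⟩ := ((eventually_norm_sub_shellLimit_le h (t + 1)).and
    ((hz.eventually (Iio_mem_nhds hκ3)).and (hδ.tendsto.eventually (Iio_mem_nhds hκ3)))).exists
  filter_upwards [eventually_norm_sub_shellMartingale_lt (P := P) hc (hδ.pos j) h3 t (hj t),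
    Iio_mem_nhds (show t < t + 1 from lt_add_one t)] with u hu hut
  rw [dist_eq_norm]
  have a1 := h1 u (le_of_lt hut)
  have a2 := h1 t le_self_add
  have a3 : 2 * (2⁻¹ : ℝ) ^ j < κ / 3 := h2
  calc ‖X u ω - shellLimit X P δ u ω - (X t ω - shellLimit X P δ t ω)‖
      = ‖((X u ω - shellMartingale X P (δ j) 1 u ω) - (X t ω - shellMartingale X P (δ j) 1 t ω)) +
        ((shellMartingale X P (δ j) 1 u ω - shellLimit X P δ u ω) -
          (shellMartingale X P (δ j) 1 t ω - shellLimit X P δ t ω))‖ := by congr 1; abel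
    _ ≤ _ := norm_add_le _ _
    _ < κ := by
        linarith [norm_sub_le (shellMartingale X P (δ j) 1 u ω - shellLimit X P δ u ω)
          (shellMartingale X P (δ j) 1 t ω - shellLimit X P δ t ω)]

lemma stronglyMeasurable_shellLimit {m : MeasurableSpace Ω} {t : ℝ≥0}
    (h : ∀ j, StronglyMeasurable[m] (shellMartingale X P (δ j) 1 t)) :
    StronglyMeasurable[m] (shellLimit X P δ t) :=
  @StronglyMeasurable.limUnder ℕ Ω _ m _ _ _ _ _ _ _ h

/-- The event on which the paths of the process decompose. -/
def goodEvent (X : ℝ≥0 → Ω → EuclideanSpace ℝ (Fin n)) (P : Measure Ω) (δ : ℕ → ℝ) : Set Ω :=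
  {ω | (∀ t, ‖jump (fun s => X s ω) t‖ ≤ 1) ∧ ∀ᶠ j : ℕ in atTop, ∀ s ≤ (j : ℝ≥0),
      ‖shellMartingale X P (δ (j + 1)) 1 s ω - shellMartingale X P (δ j) 1 s ω‖ ≤ 2⁻¹ ^ j}

/-- The continuous part of the process. -/
def continuousPart (X : ℝ≥0 → Ω → EuclideanSpace ℝ (Fin n)) (P : Measure Ω) (δ : ℕ → ℝ) (t : ℝ≥0) :
    Ω → EuclideanSpace ℝ (Fin n) :=
  (toMeasurable P (goodEvent X P δ)ᶜ)ᶜ.indicator fun ω => X t ω - shellLimit X P δ t ω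

lemma continuous_continuousPart (hc : ∀ ω, IsCadlag fun t => X t ω) (hδ : IsFastSequence X P δ)
    (ω : Ω) : Continuous fun t => continuousPart X P δ t ω := by
  by_cases h : ω ∈ (toMeasurable P (goodEvent X P δ)ᶜ)ᶜ
  · have hg : ω ∈ goodEvent X P δ := by
      by_contra h'
      exact h (subset_toMeasurable _ _ h')
    simp only [continuousPart, Set.indicator_of_mem h]
    exact continuous_sub_shellLimit (hc ω) hδ hg.1 hg.2
  · simp only [continuousPart, Set.indicator_of_notMem h]
    exact continuous_const

lemma IsCadlag.sub_continuous {E : Type*} [NormedAddCommGroup E] {x y : ℝ≥0 → E} (hx : IsCadlag x)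
    (hy : Continuous y) : IsCadlag fun t => x t - y t := fun t =>
  ⟨(hx t).1.sub hy.continuousWithinAt, by
    obtain ⟨l, hl⟩ := (hx t).2
    exact ⟨l - y t, hl.sub ((hy.tendsto t).mono_left nhdsWithin_le_nhds)⟩⟩

lemma IsCentredLevyProcess.ae_mem_goodEvent [IsProbabilityMeasure P]
    (hX : IsCentredLevyProcess X ℱ P)
    (hjump : ∀ᵐ ω ∂P, ∀ t, ‖jump (fun s => X s ω) t‖ ≤ 1) (hδ : IsFastSequence X P δ) :
    ∀ᵐ ω ∂P, ω ∈ (toMeasurable P (goodEvent X P δ)ᶜ)ᶜ ∧ ω ∈ goodEvent X P δ := by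
  have h : ∀ᵐ ω ∂P, ω ∈ goodEvent X P δ := hjump.and (hX.ae_eventually_norm_sub_le hδ)
  refine Filter.Eventually.and ?_ h
  rw [ae_iff]
  simp only [Set.mem_compl_iff, not_not]
  change P (toMeasurable P (goodEvent X P δ)ᶜ) = 0
  rw [measure_toMeasurable]
  exact h

/-- Setting the continuous part to 0 on an exceptional set preserves adaptedness because that set is
null and so belongs to every `ℱ t`. The measurable hull serves because `goodEvent` is not shown to
be measurable. -/
lemma IsCentredLevyProcess.stronglyMeasurable_continuousPart [IsProbabilityMeasure P]
    (hX : IsCentredLevyProcess X ℱ P)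
    (hℱ : ContainsNullSets ℱ P) (hjump : ∀ᵐ ω ∂P, ∀ t, ‖jump (fun s => X s ω) t‖ ≤ 1)
    (hδ : IsFastSequence X P δ) (t : ℝ≥0) : StronglyMeasurable[ℱ t] (continuousPart X P δ t) := by
  have hnull : P (toMeasurable P (goodEvent X P δ)ᶜ) = 0 := by
    have := (hX.ae_mem_goodEvent hjump hδ).mono fun ω h => h.1
    simpa [ae_iff] using this
  refine StronglyMeasurable.indicator ?_
    (MeasurableSet.compl (hℱ t _ (measurableSet_toMeasurable _ _) hnull))
  exact (hX.adapted t).stronglyMeasurable.sub (stronglyMeasurable_shellLimit (fun j =>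
    (hX.martingale_shellMartingale (hδ.pos j) (hδ.le_one j)).1 t))

lemma IsCentredLevyProcess.ae_tendsto_jumpPart [IsProbabilityMeasure P]
    (hX : IsCentredLevyProcess X ℱ P)
    (hjump : ∀ᵐ ω ∂P, ∀ t, ‖jump (fun s => X s ω) t‖ ≤ 1) (hδ : IsFastSequence X P δ) (t : ℝ≥0) :
    ∀ᵐ ω ∂P, Tendsto (fun j => shellMartingale X P (δ j) 1 t ω) atTop
      (𝓝 (X t ω - continuousPart X P δ t ω)) := by
  filter_upwards [hX.ae_mem_goodEvent hjump hδ] with ω hω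
  rw [continuousPart, Set.indicator_of_mem hω.1, sub_sub_cancel]
  exact tendsto_shellLimit hω.2.2 t

/-- Fatou's lemma along `δ`, with `r` arbitrary, so that the `L²` convergence holds for the full
limit `r ↓ 0` and not only along the chosen sequence. -/
lemma IsCentredLevyProcess.eLpNorm_sub_jumpPart_le [IsProbabilityMeasure P]
    (hX : IsCentredLevyProcess X ℱ P)
    (hjump : ∀ᵐ ω ∂P, ∀ t, ‖jump (fun s => X s ω) t‖ ≤ 1) (hδ : IsFastSequence X P δ) (t : ℝ≥0)
    {r : ℝ} (hr : 0 < r) (hr1 : r ≤ 1) :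
    eLpNorm (shellMartingale X P r 1 t - fun ω => X t ω - continuousPart X P δ t ω) 2 P ^ 2 ≤
      t * smallJumpEnergy X P r := by
  have hm := fun j => hX.memLp_shellMartingale (hδ.pos j) (hδ.le_one j) t
  have hmr := hX.memLp_shellMartingale hr hr1 t
  have h1 := Lp.eLpNorm_lim_le_liminf_eLpNorm (p := 2)
    (f := fun j => shellMartingale X P r 1 t - shellMartingale X P (δ j) 1 t)
    (fun j => (hmr.sub (hm j)).1)
    (shellMartingale X P r 1 t - fun ω => X t ω - continuousPart X P δ t ω) (by
      filter_upwards [hX.ae_tendsto_jumpPart hjump hδ t] with ω hω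
      exact hω.const_sub _)
  have h2 : ∀ᶠ j in atTop, eLpNorm (shellMartingale X P r 1 t - shellMartingale X P (δ j) 1 t) 2 P ≤
      (t * smallJumpEnergy X P r) ^ (2 : ℝ)⁻¹ := by
    filter_upwards [hδ.tendsto.eventually (Iio_mem_nhds hr)] with j hj
    have h3 := hX.eLpNorm_shellMartingale_sub_le (hδ.pos j) (le_of_lt hj) hr1 t
    rwa [eLpNorm_sub_comm, ENNReal.le_rpow_inv_iff two_pos, ENNReal.rpow_two]
  have h3 := h1.trans (liminf_le_of_frequently_le' h2.frequently)
  rwa [ENNReal.le_rpow_inv_iff two_pos, ENNReal.rpow_two] at h3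

lemma IsCentredLevyProcess.tendsto_eLpNorm_sub_jumpPart [IsProbabilityMeasure P]
    (hX : IsCentredLevyProcess X ℱ P)
    (hjump : ∀ᵐ ω ∂P, ∀ t, ‖jump (fun s => X s ω) t‖ ≤ 1) (hδ : IsFastSequence X P δ) (t : ℝ≥0) :
    Tendsto (fun r => eLpNorm (shellMartingale X P r 1 t -
      fun ω => X t ω - continuousPart X P δ t ω) 2 P) (𝓝[>] 0) (𝓝 0) := by
  have h1 : Tendsto (fun r => t * smallJumpEnergy X P r) (𝓝[>] 0) (𝓝 (t * 0)) :=
    ENNReal.Tendsto.const_mul hX.tendsto_smallJumpEnergy (Or.inr ENNReal.coe_ne_top)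
  rw [mul_zero] at h1
  have h2 : Tendsto (fun r => eLpNorm (shellMartingale X P r 1 t -
      fun ω => X t ω - continuousPart X P δ t ω) 2 P ^ 2) (𝓝[>] 0) (𝓝 0) := by
    refine tendsto_of_tendsto_of_tendsto_of_le_of_le' tendsto_const_nhds h1
      (Eventually.of_forall fun _ => zero_le) ?_
    filter_upwards [self_mem_nhdsWithin, mem_nhdsWithin_of_mem_nhds (Iio_mem_nhds one_pos)]
      with r hr hr1
    exact hX.eLpNorm_sub_jumpPart_le hjump hδ t hr (le_of_lt hr1)
  have h3 := (ENNReal.continuous_rpow_const (y := (2 : ℝ)⁻¹)).tendsto 0 |>.comp h2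
  simp only [Function.comp_def, ← ENNReal.rpow_natCast, ← ENNReal.rpow_mul] at h3
  simpa using h3

lemma IsCentredLevyProcess.isCompensatedSmallJumpIntegral [IsProbabilityMeasure P]
    (hX : IsCentredLevyProcess X ℱ P)
    (hℱ : ContainsNullSets ℱ P) (hjump : ∀ᵐ ω ∂P, ∀ t, ‖jump (fun s => X s ω) t‖ ≤ 1)
    (hδ : IsFastSequence X P δ) :
    IsCompensatedSmallJumpIntegral (fun t ω => X t ω - continuousPart X P δ t ω) X ℱ P := by
  have hm := fun j t => hX.memLp_shellMartingale (hδ.pos j) (hδ.le_one j) t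
  have hsm : ∀ t, StronglyMeasurable[ℱ t] fun ω => X t ω - continuousPart X P δ t ω := fun t =>
    (hX.adapted t).stronglyMeasurable.sub (hX.stronglyMeasurable_continuousPart hℱ hjump hδ t)
  have hlim : ∀ t, Tendsto (fun j => eLpNorm (shellMartingale X P (δ j) 1 t -
      fun ω => X t ω - continuousPart X P δ t ω) 2 P) atTop (𝓝 0) := fun t =>
    (hX.tendsto_eLpNorm_sub_jumpPart hjump hδ t).comp
      (tendsto_nhdsWithin_iff.2 ⟨hδ.tendsto, Eventually.of_forall hδ.pos⟩)
  have hmem : ∀ t, MemLp (fun ω => X t ω - continuousPart X P δ t ω) 2 P := by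
    intro t
    obtain ⟨j, hj⟩ := ((hlim t).eventually (Iio_mem_nhds ENNReal.zero_lt_top)).exists
    have h1 : MemLp (shellMartingale X P (δ j) 1 t -
        fun ω => X t ω - continuousPart X P δ t ω) 2 P :=
      ⟨(hm j t).1.sub ((hsm t).mono (ℱ.le t)).aestronglyMeasurable, hj⟩
    have h2 := (hm j t).sub h1
    rwa [sub_sub_cancel] at h2
  refine ⟨?_, fun ω => ?_, hmem, fun t => ?_⟩
  · refine martingale_of_tendsto_eLpNorm
      (fun j => hX.martingale_shellMartingale (hδ.pos j) (hδ.le_one j)) hsm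
      (fun t => (hmem t).integrable (by norm_num)) fun t => ?_
    refine tendsto_of_tendsto_of_tendsto_of_le_of_le tendsto_const_nhds (hlim t)
      (fun _ => zero_le) fun j => ?_
    exact eLpNorm_le_eLpNorm_of_exponent_le one_le_two ((hm j t).sub (hmem t)).1
  · exact (hX.cadlag ω).sub_continuous (continuous_continuousPart hX.cadlag hδ ω)
  · refine (hX.tendsto_eLpNorm_sub_jumpPart hjump hδ t).congr' ?_
    filter_upwards [self_mem_nhdsWithin] with r hr
    congr 1
    ext1 ω
    rw [Pi.sub_apply, compensatedJumpSum_shell hX.cadlag hr]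

end Decomposition

end

end LevyIto

theorem mainTheorem10 {n : ℕ} {Ω : Type*} {mΩ : MeasurableSpace Ω}
    (P : Measure Ω) [IsProbabilityMeasure P]
    (ℱ : Filtration ℝ≥0 mΩ) (hℱ : LevyIto.ContainsNullSets ℱ P)
    (X : ℝ≥0 → Ω → EuclideanSpace ℝ (Fin n))
    (hX : LevyIto.IsLevyProcess X ℱ P)
    (hcadlag : ∀ ω, LevyIto.IsCadlag fun t => X t ω)
    (hjump : ∀ᵐ ω ∂P, ∀ t, ‖LevyIto.jump (fun s => X s ω) t‖ ≤ 1)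
    (hcentred : ∀ t, ∫ ω, X t ω ∂P = 0) :
    (∃ Xc Xd : ℝ≥0 → Ω → EuclideanSpace ℝ (Fin n),
      (∀ t ω, X t ω = Xc t ω + Xd t ω) ∧
      Martingale Xc ℱ P ∧
      (∀ ω, Continuous fun t => Xc t ω) ∧
      LevyIto.IsCompensatedSmallJumpIntegral Xd X ℱ P) ∧
    ∫⁻ x in {x | ‖x‖ ≤ 1}, ‖x‖ₑ ^ 2 ∂(LevyIto.levyMeasure X P) < ∞ := by
  have hX' : LevyIto.IsCentredLevyProcess X ℱ P :=
    ⟨hX, hcadlag, hX.memLp_two hcadlag hjump, hcentred⟩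
  obtain ⟨δ, hδ⟩ := hX'.exists_isFastSequence
  have hXd := hX'.isCompensatedSmallJumpIntegral hℱ hjump hδ
  refine ⟨⟨LevyIto.continuousPart X P δ, fun t ω => X t ω - LevyIto.continuousPart X P δ t ω,
    fun t ω => by simp, ?_, LevyIto.continuous_continuousPart hcadlag hδ, hXd⟩,
    hX'.lintegral_sq_lt_top⟩
  -- The continuous part is a martingale as the difference of `X` and the jump part.
  have h := hX'.martingale.sub hXd.martingale
  convert h using 1
  ext1 t
  ext1 ω
  simp
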